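/- A \emph{straight-line program} of length $L$ over $\mathbb{C}$ is a list of $L$ instructions, each of which loads a constant $c\in\mathbb{C}$ or computes $u+v$, $u-v$ or $u\cdot v$, where $u,v$ are the variable $x$ or results of earlier instructions; it represents the polynomial $f\in\mathbb{C}[x]$ that is the result of its last instruction. A $t$-nomial is a polynomial with at most $t$ nonzero terms. There is a deterministic algorithm which, given $t\ge 1$ and a straight-line program of length $L\ge 1$ that represents a $t$-nomial $f\in\mathbb{C}[x]$, returns the monomial expansion of $f$, that is, the number $m\le t$ of its nonzero terms, their exponents $\alpha_1,\dots,\alpha_m\in\mathbb{Z}_{\ge 0}$ (pairwise distinct) and their coefficients $a_1,\dots,a_m\in\mathbb{C}\setminus\{0\}$, so that $f=\sum_{j=1}^m a_jx^{\alpha_j}$. Its complexity is $O(t^4L)$, with an absolute implied constant. Here an algorithm is a single program (the same for all inputs) of a random access machine with registers for natural numbers and for complex numbers; memory accesses, the operations $+,-,\cdot$ on natural numbers, the conversion of a natural number to a complex number, the operations $+,-,\cdot,/$ in $\mathbb{C}$, comparisons of natural numbers, equality tests in $\mathbb{C}$ and comparisons of real parts of complex numbers all have unit cost. Moreover, put $Df:=x\,f'$.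 For pairwise distinct positive reals $x_1,\dots,x_t$ and $f\in\mathbb{C}[x]$, let $C(f)\in\mathbb{C}^{t\times t}$ be the matrix with entries $(D^kf)(x_j)$, $0\le k\le t-1$, $1\le j\le t$, where $D^k$ is the $k$-th iterate of $D$. If $f$ has exactly $t$ nonzero terms, with exponents $\alpha_1,\dots,\alpha_t$, then $C(f)$ is invertible and the characteristic polynomial of $C(Df)\,C(f)^{-1}$ is $\prod_{j=1}^t(\lambda-\alpha_j)$; that is, the eigenvalues of this matrix are exactly the exponents of $f$. -/

import Mathlib

open Polynomial

/-! ### Straight-line programs over `ℂ` in one variable -/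

/-- An instruction of a straight-line program: load a constant, or add, subtract or multiply two
values that are already available.  The natural numbers are indices of available values. -/
inductive SLPInstr : Type
  | const (c : ℂ) : SLPInstr
  | add (i j : ℕ) : SLPInstr
  | sub (i j : ℕ) : SLPInstr
  | mul (i j : ℕ) : SLPInstr

namespace SLPInstr

/-- The instruction at position `k` may only refer to the values `0, …, k`: value `0` is the
variable, and value `i + 1` is the result of the instruction at position `i`. -/
def WellFormedAt (k : ℕ) : SLPInstr → Prop
  | const _ => True
  | add i j => i ≤ k ∧ j ≤ k
  | sub i j => i ≤ k ∧ j ≤ k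
  | mul i j => i ≤ k ∧ j ≤ k

/-- The polynomial produced by an instruction, from the polynomials available so far. -/
noncomputable def result (v : ℕ → ℂ[X]) : SLPInstr → ℂ[X]
  | const c => C c
  | add i j => v i + v j
  | sub i j => v i - v j
  | mul i j => v i * v j

/-- Numerical code of the kind of an instruction. -/
def opcode : SLPInstr → ℕ
  | const _ => 0
  | add _ _ => 1
  | sub _ _ => 2
  | mul _ _ => 3

/-- Index of the left operand (`0` for a constant). -/
def left : SLPInstr → ℕ
  | const _ => 0
  | add i _ => i
  | sub i _ => i
  | mul i _ => i

/-- Index of the right operand (`0` for a constant). -/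
def right : SLPInstr → ℕ
  | const _ => 0
  | add _ j => j
  | sub _ j => j
  | mul _ j => j

/-- The loaded constant (`0` for an arithmetic instruction). -/
def constant : SLPInstr → ℂ
  | const c => c
  | add _ _ => 0
  | sub _ _ => 0
  | mul _ _ => 0

end SLPInstr

/-- A straight-line program: a finite list of instructions, each of which refers only to the
variable and to results of earlier instructions. -/
structure SLP : Type where
  code : List SLPInstr
  wellFormed : ∀ (k : ℕ) (hk : k < code.length), (code[k]).WellFormedAt k

namespace SLP

/-- The number of instructions. -/
def length (S : SLP) : ℕ := S.code.length

/-- The instruction at position `k` (a dummy if `k` is not a position of the program). -/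
noncomputable def instr (S : SLP) (k : ℕ) : SLPInstr := S.code.getD k (SLPInstr.const 0)

/-- The values available after the first `n` instructions: value `0` is the variable `X`, and
value `i + 1` is the result of the instruction at position `i < n`. -/
noncomputable def values (S : SLP) : ℕ → ℕ → ℂ[X]
  | 0 => Function.update (fun _ => 0) 0 X
  | n + 1 => Function.update (S.values n) (n + 1) ((S.instr n).result (S.values n))

/-- The polynomial represented by a straight-line program: the result of its last instruction. -/
noncomputable def poly (S : SLP) : ℂ[X] := S.values S.length S.length

end SLP

/-! ### Random access machine programs over `ℂ`, with a step count

A machine has arrays of natural numbers (for indices and counters) and arrays of complex numbers.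
A program is a finite text; the names of the arrays it uses are fixed in the text, whereas the
positions inside an array are computed.  Every arithmetic operation, every comparison and every
access to memory counts as one step. -/

/-- The memory: `nat a i` and `cpx a i` are the entries in position `i` of the arrays named `a`. -/
structure Store : Type where
  nat : ℕ → ℕ → ℕ
  cpx : ℕ → ℕ → ℂ

/-- Expressions with natural number values. -/
inductive NExpr : Type
  | lit (n : ℕ) : NExpr
  | get (a : ℕ) (i : NExpr) : NExpr
  | add (e₁ e₂ : NExpr) : NExpr
  | sub (e₁ e₂ : NExpr) : NExpr
  | mul (e₁ e₂ : NExpr) : NExpr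

namespace NExpr

/-- Value of an expression (subtraction is truncated). -/
def eval (s : Store) : NExpr → ℕ
  | lit n => n
  | get a i => s.nat a (i.eval s)
  | add e₁ e₂ => e₁.eval s + e₂.eval s
  | sub e₁ e₂ => e₁.eval s - e₂.eval s
  | mul e₁ e₂ => e₁.eval s * e₂.eval s

/-- Number of steps of the evaluation of an expression. -/
def cost : NExpr → ℕ
  | lit _ => 1
  | get _ i => i.cost + 1
  | add e₁ e₂ => e₁.cost + e₂.cost + 1
  | sub e₁ e₂ => e₁.cost + e₂.cost + 1
  | mul e₁ e₂ => e₁.cost + e₂.cost + 1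

end NExpr

/-- Expressions with complex values: memory entries, natural numbers regarded as complex numbers,
and the four field operations. -/
inductive CExpr : Type
  | get (a : ℕ) (i : NExpr) : CExpr
  | ofNat (e : NExpr) : CExpr
  | add (e₁ e₂ : CExpr) : CExpr
  | sub (e₁ e₂ : CExpr) : CExpr
  | mul (e₁ e₂ : CExpr) : CExpr
  | div (e₁ e₂ : CExpr) : CExpr

namespace CExpr

/-- Value of an expression (a division by zero returns zero). -/
noncomputable def eval (s : Store) : CExpr → ℂ
  | get a i => s.cpx a (i.eval s)
  | ofNat e => (e.eval s : ℂ)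
  | add e₁ e₂ => e₁.eval s + e₂.eval s
  | sub e₁ e₂ => e₁.eval s - e₂.eval s
  | mul e₁ e₂ => e₁.eval s * e₂.eval s
  | div e₁ e₂ => e₁.eval s / e₂.eval s

/-- Number of steps of the evaluation of an expression. -/
def cost : CExpr → ℕ
  | get _ i => i.cost + 1
  | ofNat e => e.cost + 1
  | add e₁ e₂ => e₁.cost + e₂.cost + 1
  | sub e₁ e₂ => e₁.cost + e₂.cost + 1
  | mul e₁ e₂ => e₁.cost + e₂.cost + 1
  | div e₁ e₂ => e₁.cost + e₂.cost + 1

end CExpr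

/-- Tests: comparison of natural numbers, equality of complex numbers, and comparison of the real
parts of complex numbers. -/
inductive Test : Type
  | natLt (e₁ e₂ : NExpr) : Test
  | natEq (e₁ e₂ : NExpr) : Test
  | cpxEq (e₁ e₂ : CExpr) : Test
  | reLt (e₁ e₂ : CExpr) : Test

namespace Test

/-- Whether a test succeeds. -/
def Holds (s : Store) : Test → Prop
  | natLt e₁ e₂ => e₁.eval s < e₂.eval s
  | natEq e₁ e₂ => e₁.eval s = e₂.eval s
  | cpxEq e₁ e₂ => e₁.eval s = e₂.eval s
  | reLt e₁ e₂ => (e₁.eval s).re < (e₂.eval s).re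

/-- Number of steps of a test. -/
def cost : Test → ℕ
  | natLt e₁ e₂ => e₁.cost + e₂.cost + 1
  | natEq e₁ e₂ => e₁.cost + e₂.cost + 1
  | cpxEq e₁ e₂ => e₁.cost + e₂.cost + 1
  | reLt e₁ e₂ => e₁.cost + e₂.cost + 1

end Test

/-- Programs: assignments to one memory entry, composition, branching and while-loops. -/
inductive Program : Type
  | skip : Program
  | setNat (a : ℕ) (i e : NExpr) : Program
  | setCpx (a : ℕ) (i : NExpr) (e : CExpr) : Program
  | seq (P Q : Program) : Program
  | branch (b : Test) (P Q : Program) : Program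
  | loop (b : Test) (P : Program) : Program

namespace Store

/-- Overwrite entry `i` of the array `a` of natural numbers. -/
def setNat (s : Store) (a i v : ℕ) : Store :=
  { s with nat := Function.update s.nat a (Function.update (s.nat a) i v) }

/-- Overwrite entry `i` of the array `a` of complex numbers. -/
noncomputable def setCpx (s : Store) (a i : ℕ) (v : ℂ) : Store :=
  { s with cpx := Function.update s.cpx a (Function.update (s.cpx a) i v) }

end Store

/-- `Exec P s s' n`: the program `P`, started on the memory `s`, halts with the memory `s'` after
exactly `n` steps. -/
inductive Exec : Program → Store → Store → ℕ → Prop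
  | skip (s : Store) : Exec Program.skip s s 1
  | setNat (s : Store) (a : ℕ) (i e : NExpr) :
      Exec (Program.setNat a i e) s (s.setNat a (i.eval s) (e.eval s)) (i.cost + e.cost + 1)
  | setCpx (s : Store) (a : ℕ) (i : NExpr) (e : CExpr) :
      Exec (Program.setCpx a i e) s (s.setCpx a (i.eval s) (e.eval s)) (i.cost + e.cost + 1)
  | seq {P Q : Program} {s s' s'' : Store} {m n : ℕ} (hP : Exec P s s' m) (hQ : Exec Q s' s'' n) :
      Exec (Program.seq P Q) s s'' (m + n)
  | branch_true {b : Test} {P Q : Program} {s s' : Store} {n : ℕ} (hb : b.Holds s)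
      (hP : Exec P s s' n) : Exec (Program.branch b P Q) s s' (b.cost + n)
  | branch_false {b : Test} {P Q : Program} {s s' : Store} {n : ℕ} (hb : ¬ b.Holds s)
      (hQ : Exec Q s s' n) : Exec (Program.branch b P Q) s s' (b.cost + n)
  | loop_true {b : Test} {P : Program} {s s' s'' : Store} {m n : ℕ} (hb : b.Holds s)
      (hP : Exec P s s' m) (hL : Exec (Program.loop b P) s' s'' n) :
      Exec (Program.loop b P) s s'' (b.cost + m + n)
  | loop_false {b : Test} {P : Program} {s : Store} (hb : ¬ b.Holds s) :
      Exec (Program.loop b P) s s b.cost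

/-! ### Input and output -/

/-- The memory that holds the input `(t, S)`.  The natural array `0` holds `t` and the length of
`S`; the natural arrays `1`, `2`, `3` hold the codes, left operands and right operands of the
instructions; the complex array `0` holds the constants.  All else is zero. -/
noncomputable def inputStore (t : ℕ) (S : SLP) : Store where
  nat a i :=
    match a with
    | 0 => if i = 0 then t else if i = 1 then S.length else 0
    | 1 => (S.instr i).opcode
    | 2 => (S.instr i).left
    | 3 => (S.instr i).right
    | _ => 0
  cpx a i :=
    match a with
    | 0 => (S.instr i).constant
    | _ => 0

/-- The memory holds the monomial expansion of `f` as output: entry `0` of the natural array `0` is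
the number `m` of terms, the first `m` entries of the natural array `1` are the pairwise distinct
exponents, and the first `m` entries of the complex array `0` are the nonzero coefficients. -/
def HoldsExpansion (s : Store) (f : ℂ[X]) : Prop :=
  (∀ i < s.nat 0 0, ∀ j < s.nat 0 0, s.nat 1 i = s.nat 1 j → i = j) ∧
  (∀ j < s.nat 0 0, s.cpx 0 j ≠ 0) ∧
  f = ∑ j ∈ Finset.range (s.nat 0 0), monomial (s.nat 1 j) (s.cpx 0 j)

/-! ### The matrix of values of the iterated Euler derivatives -/

/-- The operator `D f = x f'`. -/
noncomputable def eulerD (f : ℂ[X]) : ℂ[X] := X * derivative f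

/-- The matrix whose entry in row `k` and column `j` is `(Dᵏ f)(x_j)`, for `0 ≤ k < t`. -/
noncomputable def eulerMatrix {t : ℕ} (x : Fin t → ℝ) (f : ℂ[X]) : Matrix (Fin t) (Fin t) ℂ :=
  Matrix.of fun k j => (eulerD^[(k : ℕ)] f).eval (x j : ℂ)

/-!
**The algorithm.** Let `f = ∑ a_α X ^ α` have `m ≤ t` terms and put `β_α = 2 ^ α`. The values
`s_k = f(2 ^ k) = ∑ a_α β_α ^ k`, `k < 2 t`, are power sums with the distinct nodes `β_α`, so that
Prony's method applies: the coefficients of the locator polynomial `Q = ∏ (X - β_α)` are the first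
linear relation among the rows of the Hankel matrix of the `s_k`. They are found by Gaussian
elimination on the matrix `[H | 1]`, where a row is best thought of as a polynomial `q`, with the
left entries `∑ a_α q(β_α) β_α ^ j` (`pairing`) and with the coefficients of `q` as right entries.
The number of rows with a pivot is at most the rank of `H`, hence at most `m`
(`le_card_support_of_triangular`), and a row whose left part vanishes has all the `β_α` as roots by
the invertibility of the Vandermonde matrix, hence is `Q` (`eq_locator_of_pairing_eq_zero`).

The sum of the roots of `Q`, which is minus its second coefficient, is `∑ 2 ^ α`, the number whose
binary digits mark the exponents of `f`. Since `deg f ≤ 2 ^ L`, the largest exponent can be read off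
from it by bisection with `L + 1` comparisons (`exponentProgram_spec`); its power of two is
subtracted, and so on. Finally, if `P = Q / (X - β_α) = ∑ P_i X ^ i` then
`∑ P_i s_i = a_α P(β_α)` (`sum_cofactor`), which gives the coefficients by synthetic division.
The evaluation of the `s_k` takes `O(t L)` steps, the elimination `O(t ^ 3)`, and the determination
of the terms `O(t L + t ^ 2)`.

Programs are verified with a calculus of weakest preconditions with a step count (`Wp`); the rule
`Wp.forLoop` handles all loops, and `Exec.agree` shows that arrays to which a program does not assign
keep their content.

**The characteristic polynomial.** With `V` the transposed Vandermonde matrix of the exponents, `A`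
and `B` the diagonal matrices of the coefficients and of the exponents, and `E` the matrix of the
`x_j ^ α`, one has `C(f) = V A E` and `C(Df) = V B A E`, so that `C(Df) C(f)⁻¹ = V B V⁻¹`. The matrix
`E` is invertible because, by Descartes' rule of signs, a nonzero real polynomial with at most `t`
terms has fewer than `t` positive roots.
-/

/-! ### The characteristic polynomial of `C(Df) C(f)⁻¹` -/

theorem signVariations_lt_card_support {P : ℝ[X]} (hP : P ≠ 0) :
    P.signVariations < P.support.card := by
  induction h : P.support.card using Nat.strong_induction_on generalizing P with
  | _ n ih =>
    subst h
    by_cases he : P.eraseLead = 0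
    · have := signVariations_le_eraseLead_succ P
      rw [he] at this
      have hm : P = monomial P.natDegree P.leadingCoeff := by
        have := P.eraseLead_add_monomial_natDegree_leadingCoeff
        rw [he, zero_add] at this
        exact this.symm
      rw [hm, signVariations_monomial, ← hm]
      exact Finset.card_pos.2 (nonempty_support_iff.2 hP)
    · have h1 := eraseLead_support_card_lt hP
      have h2 := ih _ h1 he rfl
      have h3 := signVariations_le_eraseLead_succ P
      omega

/-- A weak form of Descartes' rule of signs. -/
theorem card_lt_card_support_of_isRoot {P : ℝ[X]} (hP : P ≠ 0) {s : Finset ℝ}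
    (hs : ∀ x ∈ s, 0 < x ∧ P.IsRoot x) : s.card < P.support.card := by
  refine lt_of_le_of_lt ?_ (signVariations_lt_card_support hP)
  refine le_trans ?_ (roots_countP_pos_le_signVariations P)
  rw [Multiset.countP_eq_card_filter]
  refine Multiset.card_le_card ((Multiset.le_iff_subset s.nodup).2 ?_)
  intro x hx
  have := hs x hx
  rw [Multiset.mem_filter, mem_roots hP]
  exact ⟨this.2, this.1⟩

/-- Generalized Vandermonde matrices with positive nodes are invertible. -/
theorem isUnit_det_generalized_vandermonde {t : ℕ} (x : Fin t → ℝ) (hx : ∀ j, 0 < x j)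
    (hinj : Function.Injective x) (e : Fin t → ℕ) (he : Function.Injective e) :
    IsUnit (Matrix.of fun l j => x j ^ e l : Matrix (Fin t) (Fin t) ℝ).det := by
  rw [isUnit_iff_ne_zero]
  intro h0
  obtain ⟨v, hv, hv0⟩ := Matrix.exists_vecMul_eq_zero_iff.2 h0
  set P : ℝ[X] := ∑ l, monomial (e l) (v l) with hPdef
  have hcoeff : ∀ l, P.coeff (e l) = v l := fun l => by
    simp [hPdef, coeff_monomial, he.eq_iff]
  have hP : P ≠ 0 := by
    rintro h
    exact hv (funext fun l => by rw [← hcoeff l, h]; simp)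
  have hcard : P.support.card ≤ t := by
    have : P.support ⊆ Finset.univ.image e := by
      intro i hi
      rw [mem_support_iff] at hi
      by_contra hni
      apply hi
      rw [hPdef, finsetSum_coeff]
      refine Finset.sum_eq_zero fun l _ => ?_
      rw [coeff_monomial, if_neg]
      rintro rfl
      exact hni (Finset.mem_image_of_mem _ (Finset.mem_univ _))
    refine (Finset.card_le_card this).trans (Finset.card_image_le.trans ?_)
    simp
  have hroots : ∀ y ∈ Finset.univ.image x, 0 < y ∧ P.IsRoot y := by
    intro y hy
    obtain ⟨j, -, rfl⟩ := Finset.mem_image.1 hy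
    refine ⟨hx j, ?_⟩
    have := congrFun hv0 j
    simpa [IsRoot, hPdef, eval_finsetSum, eval_monomial, Matrix.vecMul, dotProduct] using this
  have := card_lt_card_support_of_isRoot hP hroots
  rw [Finset.card_image_of_injective _ hinj, Finset.card_fin] at this
  omega

theorem coeff_eulerD (f : ℂ[X]) (n : ℕ) : (eulerD f).coeff n = n * f.coeff n := by
  cases n with
  | zero => simp [eulerD]
  | succ n => simp [eulerD, coeff_X_mul, coeff_derivative, mul_comm]

theorem coeff_iterate_eulerD (f : ℂ[X]) (k n : ℕ) :
    (eulerD^[k] f).coeff n = (n : ℂ) ^ k * f.coeff n := by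
  induction k with
  | zero => simp
  | succ k ih => rw [Function.iterate_succ_apply', coeff_eulerD, ih]; ring

theorem eval_iterate_eulerD (f : ℂ[X]) (k : ℕ) (z : ℂ) :
    (eulerD^[k] f).eval z = ∑ α ∈ f.support, (α : ℂ) ^ k * f.coeff α * z ^ α := by
  rw [eval_eq_sum, sum_over_range' _ (by simp) (f.natDegree + (eulerD^[k] f).natDegree + 1)
    (by omega)]
  rw [← Finset.sum_subset (s₁ := f.support)]
  · simp [coeff_iterate_eulerD]
  · intro a ha
    have := le_natDegree_of_mem_supp a ha
    rw [Finset.mem_range]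
    omega
  · intro a _ ha
    simp [coeff_iterate_eulerD, notMem_support_iff.1 ha]

theorem eulerMatrix_charpoly {t : ℕ} (x : Fin t → ℝ) (f : ℂ[X]) (hx : ∀ j, 0 < x j)
    (hinj : Function.Injective x) (hf : f.support.card = t) :
    IsUnit (eulerMatrix x f) ∧
      (eulerMatrix x (eulerD f) * (eulerMatrix x f)⁻¹).charpoly =
        ∏ α ∈ f.support, (X - C (α : ℂ)) := by
  let e : Fin t → ℕ := f.support.orderEmbOfFin hf
  have he : Function.Injective e := (f.support.orderEmbOfFin hf).injective
  have himg : f.support = Finset.univ.image e := by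
    rw [← Finset.coe_inj]
    simp [e]
  have hemem : ∀ l, f.coeff (e l) ≠ 0 := fun l =>
    mem_support_iff.1 (f.support.orderEmbOfFin_mem hf l)
  let V : Matrix (Fin t) (Fin t) ℂ := (Matrix.vandermonde fun l => (e l : ℂ)).transpose
  let A : Matrix (Fin t) (Fin t) ℂ := Matrix.diagonal fun l => f.coeff (e l)
  let B : Matrix (Fin t) (Fin t) ℂ := Matrix.diagonal fun l => (e l : ℂ)
  let E : Matrix (Fin t) (Fin t) ℂ := (Matrix.of fun l j => x j ^ e l).map Complex.ofRealHom
  have hV : IsUnit V := by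
    rw [Matrix.isUnit_iff_isUnit_det, isUnit_iff_ne_zero, Matrix.det_transpose,
      Matrix.det_vandermonde_ne_zero_iff]
    exact Nat.cast_injective.comp he
  have hA : IsUnit A := by
    rw [Matrix.isUnit_iff_isUnit_det, isUnit_iff_ne_zero, Matrix.det_diagonal]
    exact Finset.prod_ne_zero_iff.2 fun l _ => hemem l
  have hE : IsUnit E := by
    rw [Matrix.isUnit_iff_isUnit_det, show E = Complex.ofRealHom.mapMatrix _ from rfl,
      ← RingHom.map_det]
    exact (isUnit_det_generalized_vandermonde x hx hinj e he).map _
  have hC : eulerMatrix x f = V * A * E := by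
    ext k j
    rw [Matrix.mul_apply]
    simp only [eulerMatrix, Matrix.of_apply, eval_iterate_eulerD, V, A, E, Matrix.mul_diagonal]
    rw [himg, Finset.sum_image he.injOn]
    simp [Matrix.vandermonde]
  have hD : eulerMatrix x (eulerD f) = V * B * A * E := by
    ext k j
    rw [Matrix.mul_apply]
    simp only [eulerMatrix, Matrix.of_apply, ← Function.iterate_succ_apply, eval_iterate_eulerD,
      V, A, B, E, Matrix.mul_diagonal]
    rw [himg, Finset.sum_image he.injOn]
    simp [Matrix.vandermonde, pow_succ]
  have hU : IsUnit (eulerMatrix x f) := hC ▸ (hV.mul hA).mul hE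
  refine ⟨hU, ?_⟩
  have hkey : eulerMatrix x (eulerD f) * (eulerMatrix x f)⁻¹ = V * B * V⁻¹ := by
    have h1 : eulerMatrix x (eulerD f) = V * B * V⁻¹ * eulerMatrix x f := by
      rw [hC, hD]
      simp only [Matrix.mul_assoc]
      rw [Matrix.nonsing_inv_mul_cancel_left _ _ ((Matrix.isUnit_iff_isUnit_det _).1 hV)]
    rw [h1, Matrix.mul_nonsing_inv_cancel_right _ _ ((Matrix.isUnit_iff_isUnit_det _).1 hU)]
  obtain ⟨u, hu⟩ := hV
  rw [hkey, ← hu, Matrix.charpoly_units_conj, Matrix.charpoly_diagonal,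
    himg, Finset.prod_image he.injOn]

/-! ### Reasoning about programs and their cost -/

/-- Total correctness with a step count: `P`, started on `s`, halts after some number `n` of steps
with a memory `s'` such that `R s' n`. -/
def Wp (P : Program) (s : Store) (R : Store → ℕ → Prop) : Prop :=
  ∃ s' n, Exec P s s' n ∧ R s' n

namespace Store

theorem setNat_nat (s : Store) (a i v b j : ℕ) :
    (s.setNat a i v).nat b j = if b = a ∧ j = i then v else s.nat b j := by
  simp only [setNat, Function.update_apply]
  split_ifs <;> simp_all

theorem setCpx_cpx (s : Store) (a i : ℕ) (v : ℂ) (b j : ℕ) :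
    (s.setCpx a i v).cpx b j = if b = a ∧ j = i then v else s.cpx b j := by
  simp only [setCpx, Function.update_apply]
  split_ifs <;> simp_all

@[simp] theorem setNat_cpx (s : Store) (a i v : ℕ) : (s.setNat a i v).cpx = s.cpx := rfl

@[simp] theorem setCpx_nat (s : Store) (a i : ℕ) (v : ℂ) : (s.setCpx a i v).nat = s.nat := rfl

end Store

namespace Wp

theorem mono {P : Program} {s : Store} {R R' : Store → ℕ → Prop} (h : Wp P s R)
    (hR : ∀ s' n, R s' n → R' s' n) : Wp P s R' := by
  obtain ⟨s', n, h1, h2⟩ := h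
  exact ⟨s', n, h1, hR _ _ h2⟩

theorem skip_iff {s : Store} {R : Store → ℕ → Prop} : Wp .skip s R ↔ R s 1 := by
  refine ⟨?_, fun h => ⟨_, _, .skip s, h⟩⟩
  rintro ⟨s', n, h, hR⟩
  cases h
  exact hR

theorem setNat_iff {s : Store} {a : ℕ} {i e : NExpr} {R : Store → ℕ → Prop} :
    Wp (.setNat a i e) s R ↔ R (s.setNat a (i.eval s) (e.eval s)) (i.cost + e.cost + 1) := by
  refine ⟨?_, fun h => ⟨_, _, .setNat s a i e, h⟩⟩
  rintro ⟨s', n, h, hR⟩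
  cases h
  exact hR

theorem setCpx_iff {s : Store} {a : ℕ} {i : NExpr} {e : CExpr} {R : Store → ℕ → Prop} :
    Wp (.setCpx a i e) s R ↔ R (s.setCpx a (i.eval s) (e.eval s)) (i.cost + e.cost + 1) := by
  refine ⟨?_, fun h => ⟨_, _, .setCpx s a i e, h⟩⟩
  rintro ⟨s', n, h, hR⟩
  cases h
  exact hR

theorem seq_iff {P Q : Program} {s : Store} {R : Store → ℕ → Prop} :
    Wp (.seq P Q) s R ↔ Wp P s (fun s' m => Wp Q s' (fun s'' n => R s'' (m + n))) := by
  constructor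
  · rintro ⟨s', n, h, hR⟩
    cases h with
    | seq hP hQ => exact ⟨_, _, hP, _, _, hQ, hR⟩
  · rintro ⟨s', m, hP, s'', n, hQ, hR⟩
    exact ⟨_, _, .seq hP hQ, hR⟩

theorem branch_iff {b : Test} {P Q : Program} {s : Store} {R : Store → ℕ → Prop} :
    Wp (.branch b P Q) s R ↔
      (b.Holds s → Wp P s (fun s' n => R s' (b.cost + n))) ∧
      (¬ b.Holds s → Wp Q s (fun s' n => R s' (b.cost + n))) := by
  constructor
  · rintro ⟨s', n, h, hR⟩
    cases h with
    | branch_true hb hP => exact ⟨fun _ => ⟨_, _, hP, hR⟩, fun h => absurd hb h⟩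
    | branch_false hb hP => exact ⟨fun h => absurd h hb, fun _ => ⟨_, _, hP, hR⟩⟩
  · rintro ⟨h1, h2⟩
    by_cases hb : b.Holds s
    · obtain ⟨s', n, hP, hR⟩ := h1 hb
      exact ⟨_, _, .branch_true hb hP, hR⟩
    · obtain ⟨s', n, hP, hR⟩ := h2 hb
      exact ⟨_, _, .branch_false hb hP, hR⟩

end Wp

namespace Program

/-- Whether the text of the program contains an assignment to the array `a` of natural numbers. -/
def writesNat (a : ℕ) : Program → Bool
  | skip => false
  | setNat b _ _ => b == a
  | setCpx _ _ _ => false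
  | seq P Q => P.writesNat a || Q.writesNat a
  | branch _ P Q => P.writesNat a || Q.writesNat a
  | loop _ P => P.writesNat a

/-- Whether the text of the program contains an assignment to the array `a` of complex numbers. -/
def writesCpx (a : ℕ) : Program → Bool
  | skip => false
  | setNat _ _ _ => false
  | setCpx b _ _ => b == a
  | seq P Q => P.writesCpx a || Q.writesCpx a
  | branch _ P Q => P.writesCpx a || Q.writesCpx a
  | loop _ P => P.writesCpx a

end Program

/-- Two memories agree on all arrays to which the program `P` contains no assignment. -/
structure Agree (P : Program) (s s' : Store) : Prop where
  nat : ∀ a, P.writesNat a = false → s'.nat a = s.nat a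
  cpx : ∀ a, P.writesCpx a = false → s'.cpx a = s.cpx a

theorem Agree.refl (P : Program) (s : Store) : Agree P s s := ⟨fun _ _ => rfl, fun _ _ => rfl⟩

theorem Agree.trans {P : Program} {s s' s'' : Store} (h : Agree P s s') (h' : Agree P s' s'') :
    Agree P s s'' :=
  ⟨fun a ha => (h'.nat a ha).trans (h.nat a ha), fun a ha => (h'.cpx a ha).trans (h.cpx a ha)⟩

theorem Agree.of_le {P Q : Program} {s s' : Store} (h : Agree P s s')
    (hN : ∀ a, Q.writesNat a = false → P.writesNat a = false)
    (hC : ∀ a, Q.writesCpx a = false → P.writesCpx a = false) : Agree Q s s' :=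
  ⟨fun a ha => h.nat a (hN a ha), fun a ha => h.cpx a (hC a ha)⟩

theorem Exec.agree {P : Program} {s s' : Store} {n : ℕ} (h : Exec P s s' n) : Agree P s s' := by
  induction h with
  | skip s => exact .refl _ _
  | setNat s a i e =>
    refine ⟨fun b hb => ?_, fun b _ => rfl⟩
    funext j
    have : b ≠ a := by rintro rfl; simp [Program.writesNat] at hb
    simp [Store.setNat_nat, this]
  | setCpx s a i e =>
    refine ⟨fun b _ => rfl, fun b hb => ?_⟩
    funext j
    have : b ≠ a := by rintro rfl; simp [Program.writesCpx] at hb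
    simp [Store.setCpx_cpx, this]
  | seq _ _ h1 h2 =>
    exact (h1.of_le (by simp +contextual [Program.writesNat])
      (by simp +contextual [Program.writesCpx])).trans
      (h2.of_le (by simp +contextual [Program.writesNat]) (by simp +contextual [Program.writesCpx]))
  | branch_true _ _ h1 =>
    exact h1.of_le (by simp +contextual [Program.writesNat])
      (by simp +contextual [Program.writesCpx])
  | branch_false _ _ h1 =>
    exact h1.of_le (by simp +contextual [Program.writesNat])
      (by simp +contextual [Program.writesCpx])
  | loop_true _ _ _ h1 h2 =>
    exact (h1.of_le (by simp +contextual [Program.writesNat])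
      (by simp +contextual [Program.writesCpx])).trans h2
  | loop_false _ => exact .refl _ _

theorem Wp.frame {P : Program} {s : Store} {R : Store → ℕ → Prop} (h : Wp P s R) :
    Wp P s (fun s' n => R s' n ∧ Agree P s s') := by
  obtain ⟨s', n, h1, h2⟩ := h
  exact ⟨s', n, h1, h2, h1.agree⟩

/-- A scalar variable is stored at position `0` of an array of its own. -/
abbrev NExpr.var (a : ℕ) : NExpr := .get a (.lit 0)

/-- A scalar variable is stored at position `0` of an array of its own. -/
abbrev CExpr.var (a : ℕ) : CExpr := .get a (.lit 0)

/-- `for c = 0, …, bound - 1 do body`. -/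
def Program.forLoop (c : ℕ) (bound : NExpr) (body : Program) : Program :=
  .seq (.setNat c (.lit 0) (.lit 0))
    (.loop (.natLt (.var c) bound)
      (.seq body (.setNat c (.lit 0) (.add (.var c) (.lit 1)))))

/-- The rule for `for`-loops with the invariant `I`: if the bound evaluates to `n` throughout, and
each execution of the body takes at most `M` steps, then the invariant at `n` holds on exit. -/
theorem Wp.forLoop {c : ℕ} {bound : NExpr} {body : Program} {s : Store} (n M : ℕ)
    (I : ℕ → Store → Prop) (h0 : I 0 (s.setNat c 0 0))
    (hb : ∀ s', Agree (Program.forLoop c bound body) s s' → bound.eval s' = n)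
    (hc : body.writesNat c = false)
    (hI : ∀ i s', i < n → I i s' → s'.nat c 0 = i → Agree (Program.forLoop c bound body) s s' →
      Wp body s' (fun s'' m => m ≤ M ∧ I (i + 1) (s''.setNat c 0 (i + 1)))) :
    Wp (Program.forLoop c bound body) s
      (fun s' m => m ≤ (n + 1) * (M + (bound.cost + 9)) ∧ I n s' ∧
        Agree (Program.forLoop c bound body) s s') := by
  have hstep : ∀ s', Agree (.setNat c (.lit 0) (.lit 0)) s s' →
      Agree (Program.forLoop c bound body) s s' := fun s' h =>
    h.of_le (by simp +contextual [Program.forLoop, Program.writesNat])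
      (by simp [Program.writesCpx])
  have key : ∀ k i s', i + k = n → I i s' → s'.nat c 0 = i →
      Agree (Program.forLoop c bound body) s s' →
      Wp (.loop (.natLt (.var c) bound)
        (.seq body (.setNat c (.lit 0) (.add (.var c) (.lit 1))))) s'
        (fun s'' m => m ≤ k * (M + (bound.cost + 9)) + (bound.cost + 3) ∧ I n s'') := by
    intro k
    induction k with
    | zero =>
      intro i s' hi hIi hci hA
      refine ⟨s', _, .loop_false ?_, ?_, ?_⟩
      · simp [Test.Holds, NExpr.eval, hb s' hA]
        omega
      · simp [Test.cost, NExpr.cost]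
        omega
      · simpa [← hi] using hIi
    | succ k ih =>
      intro i s' hi hIi hci hA
      obtain ⟨s₁, m, hE, hm, hI1⟩ := hI i s' (by omega) hIi hci hA
      have hc1 : s₁.nat c 0 = i := by rw [hE.agree.nat c hc, hci]
      have hA1 : Agree (Program.forLoop c bound body) s s₁ := hA.trans
        (hE.agree.of_le (by simp +contextual [Program.forLoop, Program.writesNat])
          (by simp +contextual [Program.forLoop, Program.writesCpx]))
      have hE2 := Exec.setNat s₁ c (.lit 0) (.add (.var c) (.lit 1))
      have hA2 := hA1.trans (hE2.agree.of_le
        (Q := Program.forLoop c bound body)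
        (by simp +contextual [Program.forLoop, Program.writesNat]) (by simp [Program.writesCpx]))
      have heq : s₁.setNat c (NExpr.eval s₁ (.lit 0)) (NExpr.eval s₁ (.add (.var c) (.lit 1))) =
          s₁.setNat c 0 (i + 1) := by simp [NExpr.eval, hc1]
      rw [heq] at hE2 hA2
      obtain ⟨s₂, m₂, hE3, hm2, hI2⟩ := ih (i + 1) _ (by omega) hI1
        (by simp [Store.setNat_nat]) hA2
      refine ⟨s₂, _, .loop_true ?_ (.seq hE hE2) hE3, ?_, hI2⟩
      · simp [Test.Holds, NExpr.eval, hb s' hA]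
        omega
      · simp only [Test.cost, NExpr.cost]
        rw [Nat.succ_mul]
        omega
  have hE0 := Exec.setNat s c (.lit 0) (.lit 0)
  simp only [NExpr.eval] at hE0
  obtain ⟨s', m, hE, hm, hI'⟩ := key n 0 _ (by omega) h0 (by simp [Store.setNat_nat])
    (hstep _ hE0.agree)
  have hE' : Exec (Program.forLoop c bound body) s s' _ := .seq hE0 hE
  refine ⟨s', _, hE', ?_, hI', hE'.agree⟩
  simp only [NExpr.cost]
  rw [Nat.succ_mul]
  omega

-- With these rules `simp` executes code without loops symbolically and computes its cost.
attribute [simp] Wp.skip_iff Wp.setNat_iff Wp.setCpx_iff Wp.seq_iff Wp.branch_iff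
attribute [simp] Store.setNat_nat Store.setCpx_cpx
attribute [simp] NExpr.eval CExpr.eval Test.Holds NExpr.cost CExpr.cost Test.cost

/-! ### Evaluation of the straight-line program -/

/-!
Memory layout of the programs below, in addition to the input arrays.
Natural numbers: array `4` the powers `2 ^ i`; array `5` the pivots; the other numbers name scalar
variables: `10`, `11`, `14` loop counters, `12` the width of a row, `13` and `15` the start of the
current row and of the row subtracted from it, `16` the pivot of the current row, `17` whether the
locator polynomial has been found, `18` its degree, `20` an exponent.
Complex numbers: array `1` the values of the instructions; array `2` the power sums; array `3` the
rows of the elimination, one after the other; array `4` the powers `2 ^ 2 ^ i`; the other numbers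
name scalar variables.
-/

theorem SLP.values_succ_of_le (S : SLP) {n j : ℕ} (h : j ≤ n) :
    S.values (n + 1) j = S.values n j := by
  simp [SLP.values, show j ≠ n + 1 by omega]

theorem SLP.wellFormedAt_instr (S : SLP) (k : ℕ) : (S.instr k).WellFormedAt k := by
  unfold SLP.instr
  by_cases hk : k < S.code.length
  · rw [List.getD_eq_getElem _ _ hk]
    exact S.wellFormed k hk
  · rw [List.getD_eq_default _ _ (by omega)]
    trivial

theorem SLP.natDegree_values_le (S : SLP) (n j : ℕ) : (S.values n j).natDegree ≤ 2 ^ n := by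
  induction n generalizing j with
  | zero =>
    simp only [SLP.values, Function.update_apply]
    split_ifs <;> simp
  | succ n ih =>
    have h2 : 2 ^ (n + 1) = 2 ^ n + 2 ^ n := by ring
    simp only [SLP.values, Function.update_apply]
    split_ifs
    · cases S.instr n with
      | const c => simp [SLPInstr.result]
      | add i j =>
        exact (natDegree_add_le _ _).trans (by have := ih i; have := ih j; simp; omega)
      | sub i j =>
        exact (natDegree_sub_le _ _).trans (by have := ih i; have := ih j; simp; omega)
      | mul i j =>
        exact natDegree_mul_le.trans (by have := ih i; have := ih j; omega)
    · have := ih j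
      omega

theorem SLP.natDegree_poly_le (S : SLP) : S.poly.natDegree ≤ 2 ^ S.length :=
  S.natDegree_values_le _ _

/-- Tabulates `2 ^ i` in the natural array `4` and `2 ^ 2 ^ i` in the complex array `4`, for `i` up
to the length of the straight-line program. -/
def powersProgram : Program :=
  .seq (.setNat 4 (.lit 0) (.lit 1)) <|
  .seq (.setCpx 4 (.lit 0) (.ofNat (.lit 2))) <|
  .forLoop 10 (.get 0 (.lit 1)) <|
  .seq (.setNat 4 (.add (.var 10) (.lit 1)) (.add (.get 4 (.var 10)) (.get 4 (.var 10))))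
    (.setCpx 4 (.add (.var 10) (.lit 1)) (.mul (.get 4 (.var 10)) (.get 4 (.var 10))))

theorem powersProgram_spec (s : Store) (L : ℕ) (hL : s.nat 0 1 = L) :
    Wp powersProgram s (fun s' n => n ≤ 100 * (L + 1) ∧
      (∀ i ≤ L, s'.nat 4 i = 2 ^ i) ∧ ∀ i ≤ L, s'.cpx 4 i = 2 ^ 2 ^ i) := by
  unfold powersProgram
  simp only [Wp.seq_iff, Wp.setNat_iff, Wp.setCpx_iff]
  refine (Wp.forLoop L 30
    (fun i s' => (∀ j ≤ i, s'.nat 4 j = 2 ^ j) ∧ ∀ j ≤ i, s'.cpx 4 j = 2 ^ 2 ^ j)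
    ?_ ?_ rfl ?_).mono ?_
  · simp
  · intro s' h
    have := h.nat 0 rfl
    simp [this, hL]
  · intro i s' hi ⟨h1, h2⟩ hc _
    simp only [Wp.seq_iff, Wp.setNat_iff, Wp.setCpx_iff]
    refine ⟨by simp, fun j hj => ?_, fun j hj => ?_⟩
    · simp [hc]
      split_ifs with h
      · subst h
        rw [h1 i le_rfl]; ring
      · exact h1 j (by omega)
    · simp [hc]
      split_ifs with h
      · subst h
        rw [h2 i le_rfl]; ring
      · exact h2 j (by omega)
  · rintro s' n ⟨hn, h, -⟩
    refine ⟨?_, h⟩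
    simp at hn ⊢
    omega

/-- Executes the instruction in position `i`, the content of the variable `10`. -/
def stepProgram : Program :=
  .branch (.natEq (.get 1 (.var 10)) (.lit 0))
    (.setCpx 1 (.add (.var 10) (.lit 1)) (.get 0 (.var 10))) <|
  .branch (.natEq (.get 1 (.var 10)) (.lit 1))
    (.setCpx 1 (.add (.var 10) (.lit 1))
      (.add (.get 1 (.get 2 (.var 10))) (.get 1 (.get 3 (.var 10))))) <|
  .branch (.natEq (.get 1 (.var 10)) (.lit 2))
    (.setCpx 1 (.add (.var 10) (.lit 1))
      (.sub (.get 1 (.get 2 (.var 10))) (.get 1 (.get 3 (.var 10)))))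
    (.setCpx 1 (.add (.var 10) (.lit 1))
      (.mul (.get 1 (.get 2 (.var 10))) (.get 1 (.get 3 (.var 10)))))

/-- Evaluates the straight-line program at the content of the complex variable `10`; the values of
the instructions are stored in the complex array `1`. -/
def evalProgram : Program :=
  .seq (.setCpx 1 (.lit 0) (.var 10)) (.forLoop 10 (.get 0 (.lit 1)) stepProgram)

/-- The memory holds the straight-line program `S` in the input arrays. -/
structure HoldsSLP (S : SLP) (s : Store) : Prop where
  length : s.nat 0 1 = S.length
  opcode : ∀ i, s.nat 1 i = (S.instr i).opcode
  left : ∀ i, s.nat 2 i = (S.instr i).left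
  right : ∀ i, s.nat 3 i = (S.instr i).right
  constant : ∀ i, s.cpx 0 i = (S.instr i).constant

theorem HoldsSLP.of_agree {S : SLP} {s s' : Store} {P : Program} (h : HoldsSLP S s)
    (hA : Agree P s s') (h0 : P.writesNat 0 = false) (h1 : P.writesNat 1 = false)
    (h2 : P.writesNat 2 = false) (h3 : P.writesNat 3 = false) (h4 : P.writesCpx 0 = false) :
    HoldsSLP S s' := by
  constructor
  · rw [hA.nat 0 h0, h.length]
  · rw [hA.nat 1 h1]; exact h.opcode
  · rw [hA.nat 2 h2]; exact h.left
  · rw [hA.nat 3 h3]; exact h.right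
  · rw [hA.cpx 0 h4]; exact h.constant

/-- Well-formedness of the program is what makes the operands available at this point. -/
theorem stepProgram_spec {S : SLP} {s : Store} {z : ℂ} {i : ℕ} (hS : HoldsSLP S s)
    (hi : s.nat 10 0 = i) (hv : ∀ j ≤ i, s.cpx 1 j = (S.values i j).eval z) :
    Wp stepProgram s (fun s' n => n ≤ 60 ∧
      ∀ j ≤ i + 1, s'.cpx 1 j = (S.values (i + 1) j).eval z) := by
  have hres : ∀ v : ℂ, v = ((S.instr i).result (S.values i)).eval z →
      ∀ j ≤ i + 1, (s.setCpx 1 (i + 1) v).cpx 1 j = (S.values (i + 1) j).eval z := by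
    intro v hv' j hj
    by_cases h : j = i + 1
    · subst h
      simp [SLP.values, hv']
    · rw [S.values_succ_of_le (by omega), ← hv j (by omega)]
      simp [h]
  have hwf := S.wellFormedAt_instr i
  have ho := hS.opcode i
  have hl := hS.left i
  have hr := hS.right i
  have hc := hS.constant i
  cases hI : S.instr i with
  | const c =>
    rw [hI] at hres ho hc
    simp only [SLPInstr.opcode, SLPInstr.constant] at ho hc
    simp only [stepProgram, Wp.branch_iff, Wp.setCpx_iff, Test.Holds, NExpr.eval, hi, ho]
    simp only [forall_true_left, not_true_eq_false, IsEmpty.forall_iff, and_true]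
    exact ⟨by simp, hres _ (by simp [hi, hc, SLPInstr.result])⟩
  | add a b =>
    rw [hI] at hres ho hl hr hwf
    simp only [SLPInstr.opcode, SLPInstr.left, SLPInstr.right] at ho hl hr
    obtain ⟨ha, hb⟩ := hwf
    simp only [stepProgram, Wp.branch_iff, Wp.setCpx_iff, Test.Holds, NExpr.eval, hi, ho]
    norm_num
    exact fun j hj => by
      simpa using hres _ (by simp [hi, hl, hr, SLPInstr.result, hv a ha, hv b hb]) j hj
  | sub a b =>
    rw [hI] at hres ho hl hr hwf
    simp only [SLPInstr.opcode, SLPInstr.left, SLPInstr.right] at ho hl hr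
    obtain ⟨ha, hb⟩ := hwf
    simp only [stepProgram, Wp.branch_iff, Wp.setCpx_iff, Test.Holds, NExpr.eval, hi, ho]
    norm_num
    exact fun j hj => by
      simpa using hres _ (by simp [hi, hl, hr, SLPInstr.result, hv a ha, hv b hb]) j hj
  | mul a b =>
    rw [hI] at hres ho hl hr hwf
    simp only [SLPInstr.opcode, SLPInstr.left, SLPInstr.right] at ho hl hr
    obtain ⟨ha, hb⟩ := hwf
    simp only [stepProgram, Wp.branch_iff, Wp.setCpx_iff, Test.Holds, NExpr.eval, hi, ho]
    norm_num
    exact fun j hj => by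
      simpa using hres _ (by simp [hi, hl, hr, SLPInstr.result, hv a ha, hv b hb]) j hj

theorem evalProgram_spec {S : SLP} {s : Store} (hS : HoldsSLP S s) :
    Wp evalProgram s (fun s' n => n ≤ 100 * (S.length + 1) ∧
      s'.cpx 1 S.length = S.poly.eval (s.cpx 10 0)) := by
  unfold evalProgram
  simp only [Wp.seq_iff, Wp.setCpx_iff]
  refine (Wp.forLoop S.length 60
    (fun i s' => ∀ j ≤ i, s'.cpx 1 j = (S.values i j).eval (s.cpx 10 0)) ?_ ?_ rfl ?_).mono ?_
  · simp [SLP.values]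
  · intro s' h
    have := h.nat 0 rfl
    simp [this, hS.length]
  · intro i s' hi hv hc hA
    have hS' : HoldsSLP S s' := (hS.of_agree (P := .setCpx 1 (.lit 0) (.var 10))
      (Exec.setCpx s 1 _ _).agree rfl rfl rfl rfl rfl).of_agree hA rfl rfl rfl rfl rfl
    refine (stepProgram_spec hS' hc hv).mono fun s'' n h => ⟨h.1, ?_⟩
    simpa using h.2
  · rintro s' n ⟨hn, h, -⟩
    refine ⟨?_, h _ le_rfl⟩
    simp at hn ⊢
    omega

/-- Stores the values of the represented polynomial at `2 ^ k`, for `k < 2 t`, in the complex array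
`2`. -/
def samplesProgram : Program :=
  .seq (.setCpx 10 (.lit 0) (.ofNat (.lit 1))) <|
  .forLoop 11 (.add (.get 0 (.lit 0)) (.get 0 (.lit 0))) <|
  .seq evalProgram <|
  .seq (.setCpx 2 (.var 11) (.get 1 (.get 0 (.lit 1))))
    (.setCpx 10 (.lit 0) (.add (.var 10) (.var 10)))

/-- The argument is kept in the complex variable `10` and doubled after each evaluation. -/
theorem samplesProgram_spec {S : SLP} {s : Store} {t : ℕ} (hS : HoldsSLP S s)
    (ht : s.nat 0 0 = t) :
    Wp samplesProgram s (fun s' n => n ≤ (2 * t + 1) * (200 * (S.length + 1)) ∧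
      ∀ k < 2 * t, s'.cpx 2 k = S.poly.eval (2 ^ k)) := by
  unfold samplesProgram
  simp only [Wp.seq_iff, Wp.setCpx_iff]
  refine (Wp.forLoop (2 * t) (100 * (S.length + 1) + 30)
    (fun i s' => s'.cpx 10 0 = 2 ^ i ∧ ∀ k < i, s'.cpx 2 k = S.poly.eval (2 ^ k))
    ?_ ?_ rfl ?_).mono ?_
  · simp
  · intro s' h
    have := h.nat 0 rfl
    simp [this, ht]
    omega
  · intro i s' hi ⟨hx, hv⟩ hc hA
    have hS' : HoldsSLP S s' := (hS.of_agree (P := .setCpx 10 (.lit 0) (.ofNat (.lit 1)))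
      (Exec.setCpx s 10 _ _).agree rfl rfl rfl rfl rfl).of_agree hA rfl rfl rfl rfl rfl
    simp only [Wp.seq_iff, Wp.setCpx_iff]
    refine (evalProgram_spec hS').frame.mono ?_
    rintro s'' n ⟨⟨hn, hv'⟩, hA'⟩
    have e1 := hA'.nat 11 rfl
    have e2 := hA'.nat 0 rfl
    have e3 := hA'.cpx 10 rfl
    have e4 := hA'.cpx 2 rfl
    refine ⟨?_, ?_, ?_⟩
    · simp
      omega
    · simp [e3, hx]
      ring
    · intro k hk
      simp [e1, e2, e4, hc, hS'.length, hv', hx]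
      split_ifs with h
      · rw [h]
      · exact hv k (by omega)
  · rintro s' n ⟨hn, h, -⟩
    refine ⟨?_, h.2⟩
    simp at hn ⊢
    have : (2 * t + 1) * (100 * (S.length + 1) + 30 + 5 + 9 + 4) ≤
      (2 * t + 1) * (200 * (S.length + 1)) := Nat.mul_le_mul_left _ (by omega)
    nlinarith

/-! ### Power sums and the locator polynomial -/

/-- The linear functional `q ↦ ∑ a_α q(2 ^ α) (2 ^ α) ^ j`, where `f = ∑ a_α X ^ α`. -/
noncomputable def pairing (f q : ℂ[X]) (j : ℕ) : ℂ :=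
  ∑ α ∈ f.support, f.coeff α * q.eval (2 ^ α) * (2 ^ α) ^ j

/-- The monic polynomial whose roots are the powers `2 ^ α`, where `α` runs through the exponents
of `f`. -/
noncomputable def locator (f : ℂ[X]) : ℂ[X] := ∏ α ∈ f.support, (X - C (2 ^ α : ℂ))

theorem two_pow_injective : Function.Injective fun α : ℕ => (2 ^ α : ℂ) := by
  intro a b h
  have h' : ((2 ^ a : ℕ) : ℂ) = ((2 ^ b : ℕ) : ℂ) := by simpa using h
  exact Nat.pow_right_injective le_rfl (Nat.cast_injective h')

theorem eval_two_pow (f : ℂ[X]) (k : ℕ) :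
    f.eval (2 ^ k) = ∑ α ∈ f.support, f.coeff α * (2 ^ α) ^ k := by
  rw [eval_eq_sum, Polynomial.sum]
  refine Finset.sum_congr rfl fun α _ => ?_
  rw [← pow_mul, ← pow_mul, mul_comm k α]

theorem pairing_X_pow (f : ℂ[X]) (k j : ℕ) : pairing f (X ^ k) j = f.eval (2 ^ (k + j)) := by
  rw [eval_two_pow, pairing]
  refine Finset.sum_congr rfl fun α _ => ?_
  rw [eval_pow, eval_X, mul_assoc, ← pow_add]

theorem pairing_sub_C_mul (f q r : ℂ[X]) (c : ℂ) (j : ℕ) :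
    pairing f (q - C c * r) j = pairing f q j - c * pairing f r j := by
  simp only [pairing, Finset.mul_sum, ← Finset.sum_sub_distrib, eval_sub, eval_mul, eval_C]
  exact Finset.sum_congr rfl fun α _ => by ring

/-- A polynomial that is orthogonal to the first `t` monomials vanishes at the nodes `2 ^ α`, because
the Vandermonde matrix of the nodes is invertible. -/
theorem eval_eq_zero_of_pairing_eq_zero {f q : ℂ[X]} {t : ℕ} (ht : f.support.card ≤ t)
    (hq : ∀ j < t, pairing f q j = 0) {α : ℕ} (hα : α ∈ f.support) : q.eval (2 ^ α) = 0 := by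
  obtain ⟨m, hm⟩ : ∃ m, f.support.card = m := ⟨_, rfl⟩
  let e : Fin m → ℕ := f.support.orderEmbOfFin hm
  have he : Function.Injective e := (f.support.orderEmbOfFin hm).injective
  have himg : f.support = Finset.univ.image e := by
    rw [← Finset.coe_inj]
    simp [e]
  have h0 : (fun l => f.coeff (e l) * q.eval (2 ^ e l)) = 0 := by
    refine Matrix.eq_zero_of_forall_pow_sum_mul_pow_eq_zero
      (f := fun l => (2 ^ e l : ℂ)) (two_pow_injective.comp he) fun i => ?_
    have h := hq i (lt_of_lt_of_le i.2 (hm ▸ ht))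
    rw [pairing, himg, Finset.sum_image he.injOn] at h
    exact h
  rw [himg] at hα
  obtain ⟨l, -, rfl⟩ := Finset.mem_image.1 hα
  have h1 := congrFun h0 l
  exact (mul_eq_zero.1 h1).resolve_left
    (mem_support_iff.1 (f.support.orderEmbOfFin_mem hm l))

theorem monic_locator (f : ℂ[X]) : (locator f).Monic := monic_prod_X_sub_C _ _

theorem natDegree_locator (f : ℂ[X]) : (locator f).natDegree = f.support.card :=
  natDegree_finsetProd_X_sub_C_eq_card _ _

theorem eq_locator {f q : ℂ[X]} (hm : q.Monic) (hd : q.natDegree ≤ f.support.card)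
    (hq : ∀ α ∈ f.support, q.eval (2 ^ α) = 0) : q = locator f := by
  refine eq_of_monic_of_dvd_of_natDegree_le (monic_locator f) hm ?_
    (by rwa [natDegree_locator])
  refine Finset.prod_dvd_of_coprime ?_ fun α hα => dvd_iff_isRoot.2 (hq α hα)
  intro a _ b _ hab
  exact isCoprime_X_sub_C_of_isUnit_sub
    (sub_ne_zero.2 fun h => hab (two_pow_injective h)).isUnit

/-- The Hankel form of the power sums has rank at most the number of terms of `f`: a triangular
system of `k` polynomials with nonzero pivots can only exist for `k` up to that number. -/
theorem le_card_support_of_triangular {f : ℂ[X]} {k : ℕ} (q : ℕ → ℂ[X]) (p : ℕ → ℕ)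
    (hne : ∀ i < k, pairing f (q i) (p i) ≠ 0)
    (hz : ∀ i < k, ∀ i' < i, pairing f (q i) (p i') = 0) : k ≤ f.support.card := by
  let A : Matrix (Fin k) f.support ℂ := Matrix.of fun i α => f.coeff α * (q i).eval (2 ^ (α : ℕ))
  let B : Matrix f.support (Fin k) ℂ := Matrix.of fun α i => (2 ^ (α : ℕ)) ^ p i
  have hAB : ∀ i j, (A * B) i j = pairing f (q i) (p j) := fun i j => by
    rw [Matrix.mul_apply, pairing, ← Finset.sum_coe_sort f.support]
    rfl
  have hdet : (A * B).det ≠ 0 := by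
    rw [Matrix.det_of_isUpperTriangular]
    · exact Finset.prod_ne_zero_iff.2 fun i _ => by rw [hAB]; exact hne i i.2
    · intro i j hij
      rw [hAB]
      exact hz i i.2 j hij
  have h1 := Matrix.rank_of_isUnit (A * B) ((Matrix.isUnit_iff_isUnit_det _).2 hdet.isUnit)
  have h2 := (Matrix.rank_mul_le_left A B).trans A.rank_le_card_width
  rw [h1] at h2
  simpa using h2

/-- The first row of the elimination that vanishes consists of the coefficients of the locator
polynomial. -/
theorem eq_locator_of_pairing_eq_zero {f : ℂ[X]} {t k : ℕ} (ht : f.support.card ≤ t)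
    (q : ℕ → ℂ[X]) (p : ℕ → ℕ) (hne : ∀ i < k, pairing f (q i) (p i) ≠ 0)
    (hz : ∀ i < k, ∀ i' < i, pairing f (q i) (p i') = 0) {r : ℂ[X]} (hm : r.Monic)
    (hd : r.natDegree = k) (hr : ∀ j < t, pairing f r j = 0) :
    r = locator f ∧ k = f.support.card := by
  have h1 := eq_locator hm (hd.trans_le (le_card_support_of_triangular q p hne hz))
    fun α hα => eval_eq_zero_of_pairing_eq_zero ht hr hα
  exact ⟨h1, by rw [← hd, h1, natDegree_locator]⟩

/-- The cofactor of the root `2 ^ α` of the locator polynomial. -/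
noncomputable def cofactor (f : ℂ[X]) (α : ℕ) : ℂ[X] :=
  ∏ β ∈ f.support.erase α, (X - C (2 ^ β : ℂ))

theorem X_sub_C_mul_cofactor {f : ℂ[X]} {α : ℕ} (hα : α ∈ f.support) :
    (X - C (2 ^ α : ℂ)) * cofactor f α = locator f :=
  Finset.mul_prod_erase f.support (fun β => X - C (2 ^ β : ℂ)) hα

theorem natDegree_cofactor_lt {f : ℂ[X]} {α : ℕ} (hα : α ∈ f.support) :
    (cofactor f α).natDegree < f.support.card := by
  have : (cofactor f α).natDegree = (f.support.erase α).card :=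
    natDegree_finsetProd_X_sub_C_eq_card _ _
  rw [this]
  exact Finset.card_erase_lt_of_mem hα

/-- The recursion of synthetic division. -/
theorem coeff_cofactor {f : ℂ[X]} {α : ℕ} (hα : α ∈ f.support) (i : ℕ) :
    (cofactor f α).coeff i =
      (locator f).coeff (i + 1) + 2 ^ α * (cofactor f α).coeff (i + 1) := by
  rw [← X_sub_C_mul_cofactor hα, sub_mul, coeff_sub, coeff_X_mul, coeff_C_mul]
  ring

theorem eval_cofactor_ne_zero (f : ℂ[X]) (α : ℕ) : (cofactor f α).eval (2 ^ α) ≠ 0 := by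
  rw [cofactor, eval_prod, Finset.prod_ne_zero_iff]
  intro β hβ
  rw [eval_sub, eval_X, eval_C, sub_ne_zero]
  exact fun h => (Finset.ne_of_mem_erase hβ) (two_pow_injective h).symm

theorem eval_cofactor_of_ne {f : ℂ[X]} {α β : ℕ} (hβ : β ∈ f.support) (h : β ≠ α) :
    (cofactor f α).eval (2 ^ β) = 0 := by
  rw [cofactor, eval_prod]
  exact Finset.prod_eq_zero (Finset.mem_erase.2 ⟨h, hβ⟩) (by simp)

/-- The cofactor separates the term of exponent `α` from the other terms. -/
theorem sum_cofactor {f : ℂ[X]} {α : ℕ} (hα : α ∈ f.support) :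
    ∑ i ∈ Finset.range f.support.card, (cofactor f α).coeff i * f.eval (2 ^ i) =
      f.coeff α * (cofactor f α).eval (2 ^ α) := by
  have h1 : ∀ i, (cofactor f α).coeff i * f.eval (2 ^ i) =
      ∑ β ∈ f.support, f.coeff β * ((cofactor f α).coeff i * (2 ^ β) ^ i) := fun i => by
    rw [eval_two_pow, Finset.mul_sum]
    exact Finset.sum_congr rfl fun β _ => by ring
  simp only [h1]
  rw [Finset.sum_comm]
  have h2 : ∀ β ∈ f.support, ∑ i ∈ Finset.range f.support.card,
      f.coeff β * ((cofactor f α).coeff i * (2 ^ β) ^ i) =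
      f.coeff β * (cofactor f α).eval (2 ^ β) := fun β _ => by
    rw [← Finset.mul_sum, eval_eq_sum_range' (natDegree_cofactor_lt hα)]
  rw [Finset.sum_congr rfl h2]
  refine Finset.sum_eq_single_of_mem α hα fun β hβ h => ?_
  rw [eval_cofactor_of_ne hβ h, mul_zero]

/-! ### Elimination -/

/-- Writes the row `k` (variable `11`) of the block matrix `[H | 1]`, where `H` is the Hankel matrix
of the power sums, into the complex array `3`, starting at the position in the variable `13`. -/
def initRowProgram : Program :=
  .forLoop 14 (.var 12) <|
  .branch (.natLt (.var 14) (.get 0 (.lit 0)))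
    (.setCpx 3 (.add (.var 13) (.var 14)) (.get 2 (.add (.var 11) (.var 14)))) <|
  .branch (.natEq (.var 14) (.add (.get 0 (.lit 0)) (.var 11)))
    (.setCpx 3 (.add (.var 13) (.var 14)) (.ofNat (.lit 1)))
    (.setCpx 3 (.add (.var 13) (.var 14)) (.ofNat (.lit 0)))

/-- The data that are fixed during the elimination: the number `t`, the width `2 t + 1` of a row,
and the power sums. -/
structure HoldsSums (f : ℂ[X]) (t : ℕ) (s : Store) : Prop where
  size : s.nat 0 0 = t
  width : s.nat 12 0 = 2 * t + 1
  sums : ∀ k < 2 * t, s.cpx 2 k = f.eval (2 ^ k)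

theorem HoldsSums.of_agree {f : ℂ[X]} {t : ℕ} {s s' : Store} {P : Program} (h : HoldsSums f t s)
    (hA : Agree P s s') (h0 : P.writesNat 0 = false) (h1 : P.writesNat 12 = false)
    (h2 : P.writesCpx 2 = false) : HoldsSums f t s' := by
  constructor
  · rw [hA.nat 0 h0, h.size]
  · rw [hA.nat 12 h1, h.width]
  · rw [hA.cpx 2 h2]; exact h.sums

/-- The row of width `2 t + 1` that starts at position `b` belongs to the polynomial `q`: its first
`t` entries are the pairings of `q` with the monomials, the others are the coefficients of `q`. -/
def HoldsRow (f : ℂ[X]) (t : ℕ) (s : Store) (b : ℕ) (q : ℂ[X]) : Prop :=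
  (∀ j < t, s.cpx 3 (b + j) = pairing f q j) ∧ ∀ i ≤ t, s.cpx 3 (b + t + i) = q.coeff i

theorem HoldsRow.congr {f q : ℂ[X]} {t b : ℕ} {s s' : Store} (h : HoldsRow f t s b q)
    (hs : ∀ n, b ≤ n → n < b + (2 * t + 1) → s'.cpx 3 n = s.cpx 3 n) : HoldsRow f t s' b q :=
  ⟨fun j hj => by rw [hs _ (by omega) (by omega), h.1 j hj],
    fun i hi => by rw [hs _ (by omega) (by omega), h.2 i hi]⟩

theorem initRowProgram_spec {f : ℂ[X]} {t k b : ℕ} {s : Store} (hs : HoldsSums f t s) (hk : k ≤ t)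
    (hks : s.nat 11 0 = k) (hb : s.nat 13 0 = b) :
    Wp initRowProgram s (fun s' n => n ≤ (2 * t + 2) * 50 ∧ HoldsRow f t s' b (X ^ k) ∧
      ∀ n < b, s'.cpx 3 n = s.cpx 3 n) := by
  refine (Wp.forLoop (2 * t + 1) 30 (fun i s' =>
    (∀ j < i, s'.cpx 3 (b + j) =
      if j < t then f.eval (2 ^ (k + j)) else if j = t + k then 1 else 0) ∧
    ∀ n < b, s'.cpx 3 n = s.cpx 3 n) ?_ ?_ rfl ?_).mono ?_
  · simp
  · intro s' h
    simp [h.nat 12 rfl, hs.width]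
  · intro i s' hi ⟨h1, h2⟩ hc hA
    have hs' := hs.of_agree hA rfl rfl rfl
    have e11 := hA.nat 11 rfl
    have e13 := hA.nat 13 rfl
    have key : ∀ v : ℂ, (v = if i < t then f.eval (2 ^ (k + i)) else if i = t + k then 1 else 0) →
        (∀ j < i + 1, (s'.setCpx 3 (b + i) v).cpx 3 (b + j) =
          if j < t then f.eval (2 ^ (k + j)) else if j = t + k then 1 else 0) ∧
        ∀ n < b, (s'.setCpx 3 (b + i) v).cpx 3 n = s.cpx 3 n := by
      intro v hv
      refine ⟨fun j hj => ?_, fun n hn => ?_⟩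
      · by_cases h : j = i
        · subst h
          simp [hv]
        · rw [← h1 j (by omega)]
          simp [h]
      · simp [show n ≠ b + i by omega, h2 n hn]
    simp only [Wp.branch_iff, Wp.setCpx_iff, Test.Holds, NExpr.eval, CExpr.eval, hc, hs'.size, e11,
      e13, hks, hb]
    refine ⟨fun h => ⟨by simp, key _ ?_⟩, fun h => ⟨fun h' => ⟨by simp, key _ ?_⟩,
      fun h' => ⟨by simp, key _ ?_⟩⟩⟩
    · rw [if_pos h, hs'.sums _ (by omega)]
    · rw [if_neg h, if_pos h', Nat.cast_one]
    · rw [if_neg h, if_neg h', Nat.cast_zero]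
  · rintro s' n ⟨hn, ⟨h1, h2⟩, -⟩
    refine ⟨?_, ⟨fun j hj => ?_, fun i hi => ?_⟩, h2⟩
    · simp at hn
      linarith
    · rw [h1 j (by omega), if_pos hj, pairing_X_pow]
    · rw [add_assoc, h1 _ (by omega), if_neg (by omega), coeff_X_pow]
      simp

/-- Subtracts from the row that starts at the position in the variable `13` the multiple of the row
that starts at the position in the variable `15` by the factor in the complex variable `11`. -/
def subtractRowProgram : Program :=
  .forLoop 14 (.var 12) <|
  .setCpx 3 (.add (.var 13) (.var 14))
    (.sub (.get 3 (.add (.var 13) (.var 14)))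
      (.mul (.var 11) (.get 3 (.add (.var 15) (.var 14)))))

theorem subtractRowProgram_spec {f q r : ℂ[X]} {t a b : ℕ} {c : ℂ} {s : Store}
    (hs : HoldsSums f t s) (hb : s.nat 13 0 = b) (ha : s.nat 15 0 = a)
    (hab : a + (2 * t + 1) ≤ b) (hc : s.cpx 11 0 = c) (hq : HoldsRow f t s b q)
    (hr : HoldsRow f t s a r) :
    Wp subtractRowProgram s (fun s' n => n ≤ (2 * t + 2) * 50 ∧ HoldsRow f t s' b (q - C c * r) ∧
      ∀ n < b, s'.cpx 3 n = s.cpx 3 n) := by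
  refine (Wp.forLoop (2 * t + 1) 30 (fun i s' =>
    (∀ j < i, s'.cpx 3 (b + j) = s.cpx 3 (b + j) - c * s.cpx 3 (a + j)) ∧
    ∀ n, (∀ j < i, n ≠ b + j) → s'.cpx 3 n = s.cpx 3 n) ?_ ?_ rfl ?_).mono ?_
  · simp
  · intro s' h
    simp [h.nat 12 rfl, hs.width]
  · intro i s' hi ⟨h1, h2⟩ hci hA
    have e11 := hA.cpx 11 rfl
    have e13 := hA.nat 13 rfl
    have e15 := hA.nat 15 rfl
    simp only [Wp.setCpx_iff, NExpr.eval, CExpr.eval, hci, e11, e13, e15, ha, hb, hc]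
    refine ⟨by simp, fun j hj => ?_, fun n hn => ?_⟩
    · by_cases h : j = i
      · subst h
        rw [h2 (b + j) (by omega), h2 (a + j) (by omega)]
        simp
      · rw [← h1 j (by omega)]
        simp [h]
    · have h3 := hn i (by omega)
      simp [h3, h2 n fun j hj => hn j (by omega)]
  · rintro s' n ⟨hn, ⟨h1, h2⟩, -⟩
    refine ⟨?_, ⟨fun j hj => ?_, fun i hi => ?_⟩, fun n hn => h2 n (by omega)⟩
    · simp at hn
      linarith
    · rw [h1 j (by omega), hq.1 j hj, hr.1 j hj, pairing_sub_C_mul]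
    · rw [add_assoc, h1 _ (by omega), ← add_assoc, ← add_assoc, hq.2 i hi, hr.2 i hi, coeff_sub,
        coeff_C_mul]

/-- The first `k` rows are those of monic polynomials of degrees `0, …, k - 1`; each has a nonzero
entry in the column of its pivot and zeros in the columns of the earlier pivots. -/
def HoldsEchelon (f : ℂ[X]) (t k : ℕ) (s : Store) (q : ℕ → ℂ[X]) : Prop :=
  ∀ i < k, (q i).Monic ∧ (q i).natDegree = i ∧ HoldsRow f t s (i * (2 * t + 1)) (q i) ∧
    s.nat 5 i < t ∧ pairing f (q i) (s.nat 5 i) ≠ 0 ∧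
    ∀ i' < i, pairing f (q i) (s.nat 5 i') = 0

theorem HoldsEchelon.congr {f : ℂ[X]} {t k : ℕ} {s s' : Store} {q : ℕ → ℂ[X]}
    (h : HoldsEchelon f t k s q) (h5 : s'.nat 5 = s.nat 5)
    (h3 : ∀ n < k * (2 * t + 1), s'.cpx 3 n = s.cpx 3 n) : HoldsEchelon f t k s' q := by
  intro i hi
  obtain ⟨a1, a2, a3, a4⟩ := h i hi
  refine ⟨a1, a2, a3.congr fun n _ hn => h3 n ?_, by rwa [h5]⟩
  have : (i + 1) * (2 * t + 1) ≤ k * (2 * t + 1) := Nat.mul_le_mul_right _ hi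
  rw [Nat.succ_mul] at this
  omega

/-- Reduces the row `k` by the rows `0, …, k - 1`. -/
def reduceRowProgram : Program :=
  .forLoop 10 (.var 11) <|
  .seq (.setNat 15 (.lit 0) (.mul (.var 10) (.var 12))) <|
  .seq (.setCpx 11 (.lit 0) (.div (.get 3 (.add (.var 13) (.get 5 (.var 10))))
    (.get 3 (.add (.var 15) (.get 5 (.var 10))))))
  subtractRowProgram

/-- The row stays that of a monic polynomial of degree `k`, since only multiples of polynomials of
smaller degree are subtracted; and a column that has been cleared stays clear, since the later rows
vanish in the earlier pivot columns. -/
theorem reduceRowProgram_spec {f : ℂ[X]} {t k : ℕ} {s : Store} {q : ℕ → ℂ[X]}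
    (hs : HoldsSums f t s) (hks : s.nat 11 0 = k)
    (hb : s.nat 13 0 = k * (2 * t + 1)) (hq : HoldsEchelon f t k s q)
    (h0 : HoldsRow f t s (k * (2 * t + 1)) (X ^ k)) :
    Wp reduceRowProgram s (fun s' n => n ≤ (k + 1) * ((2 * t + 2) * 100) ∧
      (∀ n < k * (2 * t + 1), s'.cpx 3 n = s.cpx 3 n) ∧
      ∃ r : ℂ[X], r.Monic ∧ r.natDegree = k ∧ HoldsRow f t s' (k * (2 * t + 1)) r ∧
        ∀ i < k, pairing f r (s.nat 5 i) = 0) := by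
  refine (Wp.forLoop k ((2 * t + 2) * 50 + 30) (fun i s' =>
    (∀ n < k * (2 * t + 1), s'.cpx 3 n = s.cpx 3 n) ∧
    ∃ r : ℂ[X], r.Monic ∧ r.natDegree = k ∧ HoldsRow f t s' (k * (2 * t + 1)) r ∧
      ∀ i' < i, pairing f r (s.nat 5 i') = 0) ?_ ?_ rfl ?_).mono ?_
  · refine ⟨by simp, X ^ k, monic_X_pow k, natDegree_X_pow k, h0, by simp⟩
  · intro s' h
    simp [h.nat 11 rfl, hks]
  · rintro i s' hi ⟨h3, r, r1, r2, r3, r4⟩ hci hA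
    have hs' := hs.of_agree hA rfl rfl rfl
    have e5 := hA.nat 5 rfl
    have e13 := hA.nat 13 rfl
    obtain ⟨q1, q2, q3, q4, q5, q6⟩ := (hq.congr e5 h3) i hi
    rw [e5] at q4 q5 q6
    have hle : i * (2 * t + 1) + (2 * t + 1) ≤ k * (2 * t + 1) := by
      rw [← Nat.succ_mul]
      exact Nat.mul_le_mul_right _ hi
    simp only [Wp.seq_iff, Wp.setNat_iff, Wp.setCpx_iff]
    refine (subtractRowProgram_spec (f := f) (q := r) (r := q i) (t := t) (a := i * (2 * t + 1))
      (b := k * (2 * t + 1)) (c := pairing f r (s.nat 5 i) / pairing f (q i) (s.nat 5 i))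
      ?_ ?_ ?_ hle ?_ ?_ ?_).mono ?_
    · exact ⟨by simp [hs'.size], by simp [hs'.width], by simpa using hs'.sums⟩
    · simp [e13, hb]
    · simp [hci, hs'.width]
    · simp [hci, hs'.width, e13, hb, e5, r3.1 _ q4, q3.1 _ q4]
    · exact r3.congr (by simp)
    · exact q3.congr (by simp)
    · rintro s'' n ⟨hn, hrow, h3'⟩
      refine ⟨?_, fun n hn => ?_, _, ?_, ?_, hrow.congr (by simp), fun i' hi' => ?_⟩
      · simp
        omega
      · rw [Store.setNat_cpx, h3' n hn, ← h3 n hn]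
        simp
      · refine r1.sub_of_left (degree_lt_degree ?_)
        refine (natDegree_C_mul_le _ _).trans_lt ?_
        rw [q2, r2]
        exact hi
      · rw [natDegree_sub_eq_left_of_natDegree_lt, r2]
        refine (natDegree_C_mul_le _ _).trans_lt ?_
        rw [q2, r2]
        exact hi
      · rw [pairing_sub_C_mul]
        by_cases h : i' = i
        · rw [h, div_mul_cancel₀ _ q5, sub_self]
        · rw [r4 i' (by omega), q6 i' (by omega), mul_zero, sub_zero]
  · rintro s' n ⟨hn, h, -⟩
    refine ⟨hn.trans (Nat.mul_le_mul_left _ ?_), h⟩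
    simp
    omega

/-- Puts into the variable `16` the position of a nonzero entry among the first `t` entries of the
row that starts at the position in the variable `13`, or `t` if all these entries vanish. -/
def pivotProgram : Program :=
  .seq (.setNat 16 (.lit 0) (.get 0 (.lit 0))) <|
  .forLoop 14 (.get 0 (.lit 0)) <|
  .branch (.cpxEq (.get 3 (.add (.var 13) (.var 14))) (.ofNat (.lit 0))) .skip
    (.setNat 16 (.lit 0) (.var 14))

theorem pivotProgram_spec {t b : ℕ} {s : Store} (ht : s.nat 0 0 = t) (hb : s.nat 13 0 = b) :
    Wp pivotProgram s (fun s' n => n ≤ (t + 1) * 60 ∧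
      ((s'.nat 16 0 = t ∧ ∀ j < t, s.cpx 3 (b + j) = 0) ∨
        (s'.nat 16 0 < t ∧ s.cpx 3 (b + s'.nat 16 0) ≠ 0))) := by
  unfold pivotProgram
  simp only [Wp.seq_iff, Wp.setNat_iff]
  refine (Wp.forLoop t 30 (fun i s' => (s'.nat 16 0 = t ∧ ∀ j < i, s.cpx 3 (b + j) = 0) ∨
        (s'.nat 16 0 < t ∧ s.cpx 3 (b + s'.nat 16 0) ≠ 0)) ?_ ?_ rfl ?_).mono ?_
  · simp [ht]
  · intro s' h
    simp [h.nat 0 rfl, ht]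
  · intro i s' hi h hci hA
    have e13 := hA.nat 13 rfl
    have e3 := hA.cpx 3 rfl
    simp only [Wp.branch_iff, Wp.skip_iff, Wp.setNat_iff]
    refine ⟨fun h0 => ⟨by simp, ?_⟩, fun h0 => ⟨by simp, ?_⟩⟩
    · simp [hci, e13, hb, e3] at h0
      simp
      refine h.imp (fun h => ⟨h.1, fun j hj => ?_⟩) id
      by_cases hji : j = i
      · rw [hji, h0]
      · exact h.2 j (by omega)
    · simp [hci, e13, hb, e3] at h0
      right
      simp [hci, hi, h0]
  · rintro s' n ⟨hn, h, -⟩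
    refine ⟨?_, h⟩
    simp at hn ⊢
    omega

/-- One round of the elimination. If the reduced row vanishes then the variable `17` is set to `1`
and the variable `18` to the number of the row; otherwise the pivot is recorded. -/
def roundProgram : Program :=
  .seq (.setNat 13 (.lit 0) (.mul (.var 11) (.var 12))) <|
  .seq initRowProgram <|
  .seq reduceRowProgram <|
  .seq pivotProgram <|
  .branch (.natEq (.var 16) (.get 0 (.lit 0)))
    (.seq (.setNat 17 (.lit 0) (.lit 1)) (.setNat 18 (.lit 0) (.var 11)))
    (.setNat 5 (.var 11) (.var 16))

/-- The result of the elimination: the number of terms of `f` in the variable `18`, and the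
coefficients of the locator polynomial in the complex array `3`, from the position `t` after the one
in the variable `13`. -/
def HoldsLocator (f : ℂ[X]) (t : ℕ) (s : Store) : Prop :=
  s.nat 18 0 = f.support.card ∧ ∀ i ≤ t, s.cpx 3 (s.nat 13 0 + t + i) = (locator f).coeff i

theorem roundProgram_spec {f : ℂ[X]} {t k : ℕ} {s : Store} {q : ℕ → ℂ[X]}
    (hf : f.support.card ≤ t) (hs : HoldsSums f t s) (hk : k ≤ t) (hks : s.nat 11 0 = k)
    (hq : HoldsEchelon f t k s q) (hd : s.nat 17 0 = 0) :
    Wp roundProgram s (fun s' n => n ≤ (t + 1) * ((2 * t + 2) * 300) ∧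
      ((s'.nat 17 0 = 1 ∧ HoldsLocator f t s') ∨
        (s'.nat 17 0 = 0 ∧ ∃ q', HoldsEchelon f t (k + 1) s' q'))) := by
  unfold roundProgram
  simp only [Wp.seq_iff, Wp.setNat_iff]
  have hs₁ := hs.of_agree (Exec.setNat s 13 (.lit 0) (.mul (.var 11) (.var 12))).agree rfl rfl rfl
  have heq : s.setNat 13 (NExpr.eval s (.lit 0)) (NExpr.eval s (.mul (.var 11) (.var 12))) =
      s.setNat 13 0 (k * (2 * t + 1)) := by simp [hks, hs.width]
  rw [heq] at hs₁ ⊢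
  refine (initRowProgram_spec (b := k * (2 * t + 1)) hs₁ hk (by simp [hks])
    (by simp)).frame.mono ?_
  rintro s₂ n₂ ⟨⟨hn₂, hrow₂, h3₂⟩, hA₂⟩
  have hs₂ := hs₁.of_agree hA₂ rfl rfl rfl
  have hq₂ : HoldsEchelon f t k s₂ q := hq.congr (by rw [hA₂.nat 5 rfl]; funext j; simp) h3₂
  refine (reduceRowProgram_spec hs₂ (by simp [hA₂.nat 11 rfl, hks])
    (by simp [hA₂.nat 13 rfl]) hq₂ hrow₂).frame.mono ?_
  rintro s₃ n₃ ⟨⟨hn₃, h3₃, r, r1, r2, r3, r4⟩, hA₃⟩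
  have hs₃ := hs₂.of_agree hA₃ rfl rfl rfl
  have hq₃ : HoldsEchelon f t k s₃ q := hq₂.congr (hA₃.nat 5 rfl) h3₃
  rw [← hA₃.nat 5 rfl] at r4
  have h11 : s₃.nat 11 0 = k := by simp [hA₃.nat 11 rfl, hA₂.nat 11 rfl, hks]
  have h13 : s₃.nat 13 0 = k * (2 * t + 1) := by simp [hA₃.nat 13 rfl, hA₂.nat 13 rfl]
  have h17 : s₃.nat 17 0 = 0 := by simp [hA₃.nat 17 rfl, hA₂.nat 17 rfl, hd]
  refine (pivotProgram_spec hs₃.size h13).frame.mono ?_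
  rintro s₄ n₄ ⟨⟨hn₄, hp⟩, hA₄⟩
  have hcost : ∀ c ≤ 20, 7 + (n₂ + (n₃ + (n₄ + c))) ≤ (t + 1) * ((2 * t + 2) * 300) := by
    intro c hc
    have h1 : (k + 1) * ((2 * t + 2) * 100) ≤ (t + 1) * ((2 * t + 2) * 100) :=
      Nat.mul_le_mul_right _ (by omega)
    nlinarith
  have hs₄ := hs₃.of_agree hA₄ rfl rfl rfl
  have e5 := hA₄.nat 5 rfl
  have e11 := hA₄.nat 11 rfl
  have e13 := hA₄.nat 13 rfl
  have e17 := hA₄.nat 17 rfl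
  have e3 := hA₄.cpx 3 rfl
  simp only [Wp.branch_iff, Wp.seq_iff, Wp.setNat_iff, Test.Holds, NExpr.eval, hs₄.size]
  refine ⟨fun h => ⟨hcost _ (by simp), Or.inl ⟨by simp, ?_⟩⟩,
    fun h => ⟨hcost _ (by simp), Or.inr ⟨by simp [e17, h17], ?_⟩⟩⟩
  · -- the reduced row vanishes, so it belongs to the locator polynomial
    have hz := (hp.resolve_right fun h' => h'.1.ne h).2
    obtain ⟨hl, hkc⟩ := eq_locator_of_pairing_eq_zero hf q (s₃.nat 5)
      (fun i hi => (hq₃ i hi).2.2.2.2.1) (fun i hi => (hq₃ i hi).2.2.2.2.2) r1 r2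
      (fun j hj => by rw [← r3.1 j hj, hz j hj])
    refine ⟨by simp [e11, h11, hkc], fun i hi => ?_⟩
    rw [← hl, ← r3.2 i hi]
    simp [e13, h13, e3]
  · -- the row has a pivot and extends the echelon system
    obtain ⟨hp1, hp2⟩ := hp.resolve_left fun h' => h h'.1
    refine ⟨Function.update q k r, fun i hi => ?_⟩
    have hr₅ : ∀ b q', HoldsRow f t s₃ b q' → HoldsRow f t (s₄.setNat 5 (s₄.nat 11 0)
        (s₄.nat 16 0)) b q' := fun b q' h => h.congr (by simp [e3])
    have h5 : ∀ j < k, (s₄.setNat 5 (s₄.nat 11 0) (s₄.nat 16 0)).nat 5 j = s₃.nat 5 j := by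
      intro j hj
      simp [e11, h11, e5, hj.ne]
    have h5k : (s₄.setNat 5 (s₄.nat 11 0) (s₄.nat 16 0)).nat 5 k = s₄.nat 16 0 := by
      simp [e11, h11]
    by_cases hik : i = k
    · subst hik
      rw [Function.update_self, h5k]
      refine ⟨r1, r2, hr₅ _ _ r3, hp1, by rwa [← r3.1 _ hp1], fun i' hi' => ?_⟩
      rw [h5 i' hi', r4 i' hi']
    · have hik' : i < k := by omega
      obtain ⟨q1, q2, q3, q4, q5, q6⟩ := hq₃ i hik'
      rw [Function.update_of_ne hik, h5 i hik']
      refine ⟨q1, q2, hr₅ _ _ q3, q4, q5, fun i' hi' => ?_⟩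
      rw [h5 i' (by omega), q6 i' hi']

/-- Computes the number of terms and the locator polynomial from the power sums. -/
def locatorProgram : Program :=
  .seq (.setNat 12 (.lit 0) (.add (.add (.get 0 (.lit 0)) (.get 0 (.lit 0))) (.lit 1))) <|
  .seq (.setNat 17 (.lit 0) (.lit 0)) <|
  .forLoop 11 (.add (.get 0 (.lit 0)) (.lit 1)) <|
  .branch (.natEq (.var 17) (.lit 0)) roundProgram .skip

theorem locatorProgram_spec {f : ℂ[X]} {t : ℕ} {s : Store} (hf : f.support.card ≤ t)
    (ht : s.nat 0 0 = t) (hs : ∀ k < 2 * t, s.cpx 2 k = f.eval (2 ^ k)) :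
    Wp locatorProgram s (fun s' n => n ≤ (t + 2) * ((t + 1) * ((2 * t + 2) * 400)) ∧
      HoldsLocator f t s') := by
  unfold locatorProgram
  simp only [Wp.seq_iff, Wp.setNat_iff]
  refine (Wp.forLoop (t + 1) ((t + 1) * ((2 * t + 2) * 300) + 30) (fun k s' =>
    s'.nat 12 0 = 2 * t + 1 ∧ ((s'.nat 17 0 = 1 ∧ HoldsLocator f t s') ∨
      (s'.nat 17 0 = 0 ∧ ∃ q, HoldsEchelon f t k s' q))) ?_ ?_ rfl ?_).mono ?_
  · refine ⟨by simp [ht]; omega, Or.inr ⟨by simp, fun _ => 0, fun i hi => absurd hi (by omega)⟩⟩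
  · intro s' h
    simp [h.nat 0 rfl, ht]
  · rintro k s' hk ⟨h12, h⟩ hck hA
    have e0 := hA.nat 0 rfl
    have e2 := hA.cpx 2 rfl
    simp only [Wp.branch_iff, Wp.skip_iff]
    refine ⟨fun h0 => ?_, fun h0 => ⟨by simp, ?_⟩⟩
    · simp at h0
      obtain ⟨-, q, hq⟩ := h.resolve_left fun h' => by omega
      have hs' : HoldsSums f t s' := ⟨by simp [e0, ht], h12, by simpa [e2] using hs⟩
      refine (roundProgram_spec hf hs' (by omega) hck hq h0).frame.mono ?_
      rintro s'' n ⟨⟨hn, hR⟩, hA'⟩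
      refine ⟨?_, by simp [hA'.nat 12 rfl, h12], ?_⟩
      · simp
        omega
      · refine hR.imp (fun h => ⟨by simp [h.1], ?_⟩) fun h => ⟨by simp [h.1], ?_⟩
        · simpa [HoldsLocator] using h.2
        · exact h.2.imp fun q' hq' => hq'.congr (by funext j; simp) (by simp)
    · simp at h0
      refine ⟨by simp [h12], Or.inl ?_⟩
      simpa [HoldsLocator] using h.resolve_right fun h' => h0 h'.1
  · rintro s' n ⟨hn, ⟨-, h⟩, -⟩
    -- `t + 1` rows with pivots would exceed the rank of the Hankel matrix
    have hloc : HoldsLocator f t s' := by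
      refine (h.resolve_right ?_).2
      rintro ⟨-, q, hq⟩
      have := le_card_support_of_triangular q (s'.nat 5) (fun i hi => (hq i hi).2.2.2.2.1)
        (fun i hi => (hq i hi).2.2.2.2.2)
      omega
    refine ⟨?_, hloc⟩
    have h1 : (t + 1) * ((2 * t + 2) * 300) + 60 ≤ (t + 1) * ((2 * t + 2) * 400) := by nlinarith
    have h2 := Nat.mul_le_mul_left (t + 2) h1
    simp at hn ⊢
    linarith

/-! ### Exponents and coefficients -/

/-- Puts the largest `e` with `2 ^ e ≤ σ` into the variable `20` and `2 ^ e` into the complex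
variable `13`, where `σ` is the content of the complex variable `12`; the binary digits of `e` are
determined from the top. -/
def exponentProgram : Program :=
  .seq (.setNat 20 (.lit 0) (.lit 0)) <|
  .seq (.setCpx 13 (.lit 0) (.ofNat (.lit 1))) <|
  .forLoop 10 (.add (.get 0 (.lit 1)) (.lit 1)) <|
  .branch (.reLt (.var 12) (.mul (.var 13) (.get 4 (.sub (.get 0 (.lit 1)) (.var 10))))) .skip <|
  .seq (.setCpx 13 (.lit 0) (.mul (.var 13) (.get 4 (.sub (.get 0 (.lit 1)) (.var 10)))))
    (.setNat 20 (.lit 0) (.add (.var 20) (.get 4 (.sub (.get 0 (.lit 1)) (.var 10)))))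

/-- The hypotheses on `σ` say that `α` is the integral part of its binary logarithm. Before the digit
of weight `2 ^ (L - i)` is determined, `e ≤ α < e + 2 ^ (L + 1 - i)`. -/
theorem exponentProgram_spec {s : Store} {L α : ℕ} (hL : s.nat 0 1 = L)
    (hN : ∀ i ≤ L, s.nat 4 i = 2 ^ i) (hC : ∀ i ≤ L, s.cpx 4 i = 2 ^ 2 ^ i)
    (hα : α < 2 ^ (L + 1)) (h1 : 2 ^ α ≤ (s.cpx 12 0).re) (h2 : (s.cpx 12 0).re < 2 ^ (α + 1)) :
    Wp exponentProgram s (fun s' n => n ≤ (L + 2) * 100 ∧ s'.nat 20 0 = α ∧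
      s'.cpx 13 0 = 2 ^ α) := by
  unfold exponentProgram
  simp only [Wp.seq_iff, Wp.setNat_iff, Wp.setCpx_iff]
  refine (Wp.forLoop (L + 1) 60 (fun i s' => s'.nat 20 0 ≤ α ∧
    α < s'.nat 20 0 + 2 ^ (L + 1 - i) ∧ s'.cpx 13 0 = 2 ^ s'.nat 20 0) ?_ ?_ rfl ?_).mono ?_
  · simp [hα]
  · intro s' h
    simp [h.nat 0 rfl, hL]
  · rintro i s' hi ⟨a1, a2, a3⟩ hci hA
    have e0 : s'.nat 0 1 = L := by simp [hA.nat 0 rfl, hL]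
    have e4 : s'.nat 4 (L - i) = 2 ^ (L - i) := by
      simp [hA.nat 4 rfl, hN (L - i) (by omega)]
    have e4' : s'.cpx 4 (L - i) = 2 ^ 2 ^ (L - i) := by
      simp [hA.cpx 4 rfl, hC (L - i) (by omega)]
    have e12 : s'.cpx 12 0 = s.cpx 12 0 := by simp [hA.cpx 12 rfl]
    have hpow : 2 ^ (L + 1 - i) = 2 ^ (L - i) + 2 ^ (L - i) := by
      rw [show L + 1 - i = (L - i) + 1 by omega]; ring
    rw [hpow] at a2
    have hnext : L + 1 - (i + 1) = L - i := by omega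
    -- comparing `σ` with `2 ^ n` amounts to comparing `α` with `n`
    have hcmp : ∀ n : ℕ, (s.cpx 12 0).re < ((2 : ℂ) ^ n).re ↔ α < n := by
      intro n
      have hre : ((2 : ℂ) ^ n).re = (2 : ℝ) ^ n := by
        rw [← Complex.ofReal_ofNat, ← Complex.ofReal_pow, Complex.ofReal_re]
      rw [hre]
      constructor
      · intro h
        exact (pow_lt_pow_iff_right₀ (by norm_num : (1 : ℝ) < 2)).1 (h1.trans_lt h)
      · intro h
        exact h2.trans_le (pow_le_pow_right₀ (by norm_num) h)
    simp only [Wp.branch_iff, Wp.skip_iff, Wp.seq_iff, Wp.setNat_iff, Wp.setCpx_iff, Test.Holds,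
      NExpr.eval, CExpr.eval, e0, hci, e4', e12, a3, ← pow_add, hcmp]
    refine ⟨fun h => ⟨by simp, ?_⟩, fun h => ⟨by simp, ?_⟩⟩
    · rw [hnext]
      simpa [a1, a3] using h
    · rw [hnext]
      simp [e0, e4, hci]
      omega
  · rintro s' n ⟨hn, ⟨a1, a2, a3⟩, -⟩
    have h20 : s'.nat 20 0 = α := by
      rw [Nat.sub_self, pow_zero] at a2
      omega
    refine ⟨?_, h20, by rw [a3, h20]⟩
    simp at hn ⊢
    linarith

/-- Synthetic division of the locator polynomial by `X - β`, where `β` is the content of the complex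
variable `13`. The pairing of the quotient with the power sums is accumulated in the complex variable
`15`, and the value of the quotient at `β` in `16`. -/
def coefficientProgram : Program :=
  .seq (.setCpx 14 (.lit 0) (.ofNat (.lit 0))) <|
  .seq (.setCpx 15 (.lit 0) (.ofNat (.lit 0))) <|
  .seq (.setCpx 16 (.lit 0) (.ofNat (.lit 0))) <|
  .forLoop 10 (.var 18) <|
  .seq (.setCpx 14 (.lit 0) (.add
    (.get 3 (.add (.add (.var 13) (.get 0 (.lit 0))) (.sub (.var 18) (.var 10))))
    (.mul (.var 13) (.var 14)))) <|
  .seq (.setCpx 15 (.lit 0) (.add (.var 15)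
    (.mul (.var 14) (.get 2 (.sub (.sub (.var 18) (.lit 1)) (.var 10))))))
    (.setCpx 16 (.lit 0) (.add (.mul (.var 16) (.var 13)) (.var 14)))

/-- After `i` steps the complex variable `14` holds the coefficient of degree `m - i` of the cofactor, and
Horner's scheme is evaluated on the coefficients found so far. -/
theorem coefficientProgram_spec {f : ℂ[X]} {s : Store} {t α : ℕ} (hf : f.support.card ≤ t)
    (ht : s.nat 0 0 = t) (hs : ∀ k < 2 * t, s.cpx 2 k = f.eval (2 ^ k)) (hl : HoldsLocator f t s)
    (hα : α ∈ f.support) (hβ : s.cpx 13 0 = 2 ^ α) :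
    Wp coefficientProgram s (fun s' n => n ≤ (t + 1) * 100 ∧
      s'.cpx 15 0 / s'.cpx 16 0 = f.coeff α) := by
  obtain ⟨hm, hq⟩ := hl
  set m := f.support.card with hmdef
  set P := cofactor f α with hP
  unfold coefficientProgram
  simp only [Wp.seq_iff, Wp.setCpx_iff]
  refine (Wp.forLoop m 60 (fun i s' => s'.cpx 14 0 = P.coeff (m - i) ∧
    s'.cpx 15 0 = ∑ x ∈ Finset.range i, P.coeff (m - 1 - x) * f.eval (2 ^ (m - 1 - x)) ∧
    s'.cpx 16 0 = ∑ x ∈ Finset.range i, P.coeff (m - i + x) * (2 ^ α) ^ x) ?_ ?_ rfl ?_).mono ?_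
  · simpa using (coeff_eq_zero_of_natDegree_lt (natDegree_cofactor_lt hα)).symm
  · intro s' h
    simp [h.nat 18 rfl, hm]
  · rintro i s' hi ⟨a14, a15, a16⟩ hci hA
    have e0 : s'.nat 0 0 = t := by simp [hA.nat 0 rfl, ht]
    have e13 := hA.nat 13 rfl
    have e18 : s'.nat 18 0 = m := by simp [hA.nat 18 rfl, hm]
    have e2 : s'.cpx 2 (m - 1 - i) = f.eval (2 ^ (m - 1 - i)) := by
      simp [hA.cpx 2 rfl, hs (m - 1 - i) (by omega)]
    have e3 : s'.cpx 3 (s'.nat 13 0 + t + (m - i)) = (locator f).coeff (m - i) := by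
      rw [hA.cpx 3 rfl, e13]
      simpa using hq (m - i) (by omega)
    have eβ : s'.cpx 13 0 = 2 ^ α := by simp [hA.cpx 13 rfl, hβ]
    have hrec : (locator f).coeff (m - i) + 2 ^ α * P.coeff (m - i) = P.coeff (m - 1 - i) := by
      have := coeff_cofactor hα (m - 1 - i)
      rw [show m - 1 - i + 1 = m - i by omega] at this
      exact this.symm
    have hidx : m - (i + 1) = m - 1 - i := by omega
    simp only [Wp.seq_iff, Wp.setCpx_iff]
    refine ⟨by simp, ?_, ?_, ?_⟩
    · simp [e0, e18, hci, e3, eβ, a14, hrec, hidx]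
    · simp [e0, e18, hci, e3, eβ, a14, hrec, a15, e2, Finset.sum_range_succ]
    · simp [e0, e18, hci, e3, eβ, a14, hrec, hidx, a16, Finset.sum_range_succ', Finset.sum_mul]
      refine Finset.sum_congr rfl fun x _ => ?_
      rw [show m - 1 - i + (x + 1) = m - i + x by omega]
      ring
  · rintro s' n ⟨hn, ⟨-, a15, a16⟩, -⟩
    rw [Finset.sum_range_reflect (fun x => P.coeff x * f.eval (2 ^ x)) m, hP, sum_cofactor hα] at a15
    simp only [Nat.sub_self, zero_add] at a16
    rw [← eval_eq_sum_range' (natDegree_cofactor_lt hα)] at a16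
    refine ⟨?_, ?_⟩
    · simp at hn ⊢
      linarith
    · rw [a15, a16, mul_div_cancel_right₀ _ (eval_cofactor_ne_zero f α)]

/-- Determines one term, whose number is in the variable `11`, and removes its node from the sum in
the complex variable `12`. -/
def termProgram : Program :=
  .seq exponentProgram <|
  .seq (.setCpx 12 (.lit 0) (.sub (.var 12) (.var 13))) <|
  .seq coefficientProgram <|
  .seq (.setNat 1 (.var 11) (.var 20))
    (.setCpx 0 (.var 11) (.div (.var 15) (.var 16)))

/-- Reads off the terms from the locator polynomial, starting from the sum of its roots. -/
def termsProgram : Program :=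
  .seq (.setCpx 12 (.lit 0) (.sub (.ofNat (.lit 0))
    (.get 3 (.add (.add (.var 13) (.get 0 (.lit 0))) (.sub (.var 18) (.lit 1)))))) <|
  .seq (.forLoop 11 (.var 18) termProgram)
    (.setNat 0 (.lit 0) (.var 18))

theorem coeff_locator_eq_neg_sum {f : ℂ[X]} (hf : 0 < f.support.card) :
    (locator f).coeff (f.support.card - 1) = -∑ α ∈ f.support, (2 ^ α : ℂ) := by
  rw [← prod_X_sub_C_nextCoeff (fun α : ℕ => (2 ^ α : ℂ)), ← locator,
    nextCoeff_of_natDegree_pos (by rwa [natDegree_locator]), natDegree_locator]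

/-- A sum of distinct powers of two determines the largest of them. -/
theorem two_pow_max'_le_sum {A : Finset ℕ} (hA : A.Nonempty) :
    (2 : ℝ) ^ A.max' hA ≤ (∑ α ∈ A, (2 ^ α : ℂ)).re ∧
      (∑ α ∈ A, (2 ^ α : ℂ)).re < 2 ^ (A.max' hA + 1) := by
  have hre : (∑ α ∈ A, (2 ^ α : ℂ)).re = ((∑ α ∈ A, 2 ^ α : ℕ) : ℝ) := by
    rw [← Complex.natCast_re]
    push_cast
    rfl
  rw [hre]
  constructor
  · exact_mod_cast Finset.single_le_sum (f := fun α => 2 ^ α) (fun _ _ => Nat.zero_le _)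
      (A.max'_mem hA)
  · exact_mod_cast Nat.geomSum_lt le_rfl fun k hk => Nat.lt_succ_of_le (A.le_max' k hk)

/-- After `l` terms have been found: they are terms of `f` with distinct exponents, and the content
`σ` of the complex variable `12` is the sum of the nodes of the other terms. -/
def HoldsTerms (f : ℂ[X]) (l : ℕ) (s : Store) : Prop :=
  (∀ i < l, s.cpx 0 i = f.coeff (s.nat 1 i)) ∧
  (∀ i < l, ∀ j < l, s.nat 1 i = s.nat 1 j → i = j) ∧
  ∃ A ⊆ f.support, A.card + l = f.support.card ∧ (∀ i < l, s.nat 1 i ∈ f.support \ A) ∧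
    (l < f.support.card → s.cpx 12 0 = ∑ α ∈ A, 2 ^ α)

theorem termProgram_spec {f : ℂ[X]} {s : Store} {t L l : ℕ} (hf : f.support.card ≤ t)
    (hdeg : f.natDegree ≤ 2 ^ L) (ht : s.nat 0 0 = t) (hL : s.nat 0 1 = L)
    (hs : ∀ k < 2 * t, s.cpx 2 k = f.eval (2 ^ k)) (hloc : HoldsLocator f t s)
    (hN : ∀ i ≤ L, s.nat 4 i = 2 ^ i) (hC : ∀ i ≤ L, s.cpx 4 i = 2 ^ 2 ^ i)
    (hls : s.nat 11 0 = l) (hl : l < f.support.card) (hT : HoldsTerms f l s) :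
    Wp termProgram s (fun s' n => n ≤ (L + 2) * 100 + (t + 1) * 200 ∧
      HoldsTerms f (l + 1) s') := by
  obtain ⟨T1, T2, A, T3, T4, T5, T6⟩ := hT
  have hA : A.Nonempty := Finset.card_pos.1 (by omega)
  set α := A.max' hA with hαdef
  have hαA : α ∈ A := A.max'_mem hA
  have hαf : α ∈ f.support := T3 hαA
  obtain ⟨b1, b2⟩ := two_pow_max'_le_sum hA
  rw [← T6 hl] at b1 b2
  have hαL : α < 2 ^ (L + 1) := by
    have h1 := le_natDegree_of_mem_supp α hαf
    have h2 : 2 ^ L < 2 ^ (L + 1) := Nat.pow_lt_pow_right (by norm_num) (by omega)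
    omega
  unfold termProgram
  simp only [Wp.seq_iff, Wp.setNat_iff, Wp.setCpx_iff]
  refine (exponentProgram_spec hL hN hC hαL b1 b2).frame.mono ?_
  rintro s₁ n₁ ⟨⟨hn₁, h20, h13⟩, hA₁⟩
  refine (coefficientProgram_spec (f := f) (t := t) (α := α) hf ?_ ?_ ?_ hαf ?_).frame.mono ?_
  · simp [hA₁.nat 0 rfl, ht]
  · simpa [hA₁.cpx 2 rfl] using hs
  · simpa [HoldsLocator, hA₁.nat 18 rfl, hA₁.nat 13 rfl, hA₁.cpx 3 rfl] using hloc
  · simp [h13]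
  rintro s₂ n₂ ⟨⟨hn₂, hq⟩, hA₂⟩
  have e11 : s₂.nat 11 0 = l := by simp [hA₂.nat 11 rfl, hA₁.nat 11 rfl, hls]
  have e20 : s₂.nat 20 0 = α := by simp [hA₂.nat 20 rfl, h20]
  have e1 : s₂.nat 1 = s.nat 1 := by simp [hA₂.nat 1 rfl, hA₁.nat 1 rfl]
  have e0 : ∀ i, s₂.cpx 0 i = s.cpx 0 i := fun i => by simp [hA₂.cpx 0 rfl, hA₁.cpx 0 rfl]
  have e12 : s₂.cpx 12 0 = s.cpx 12 0 - 2 ^ α := by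
    simp [hA₂.cpx 12 rfl, hA₁.cpx 12 rfl, h13]
  refine ⟨by simp; linarith, fun i hi => ?_, fun i hi j hj => ?_, A.erase α,
    (A.erase_subset α).trans T3, ?_, fun i hi => ?_, fun _ => ?_⟩
  · by_cases h : i = l
    · simp [h, e11, e20, hq]
    · simp [h, e11, e1, e0, T1 i (by omega)]
  · have hne : ∀ i < l, s.nat 1 i ≠ α := fun i hi h =>
      (Finset.mem_sdiff.1 (T5 i hi)).2 (h ▸ hαA)
    by_cases h : i = l <;> by_cases h' : j = l
    · simp [h, h']
    · simp [h, h', e11, e20, e1]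
      exact fun hij => absurd hij.symm (hne j (by omega))
    · simp [h, h', e11, e20, e1]
      exact fun hij => absurd hij (hne i (by omega))
    · simp [h, h', e11, e1]
      exact T2 i (by omega) j (by omega)
  · rw [Finset.card_erase_of_mem hαA]
    have := Finset.card_pos.2 hA
    omega
  · by_cases h : i = l
    · simp [h, e11, e20, mem_support_iff.1 hαf]
    · have h5 := Finset.mem_sdiff.1 (T5 i (by omega))
      simp [h, e11, e1, mem_support_iff.1 h5.1, h5.2]
  · have := Finset.add_sum_erase A (fun α => (2 ^ α : ℂ)) hαA
    simp [e12, T6 hl, ← this]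

theorem termsProgram_spec {f : ℂ[X]} {s : Store} {t L : ℕ} (hf : f.support.card ≤ t)
    (hdeg : f.natDegree ≤ 2 ^ L) (ht : s.nat 0 0 = t) (hL : s.nat 0 1 = L)
    (hs : ∀ k < 2 * t, s.cpx 2 k = f.eval (2 ^ k)) (hloc : HoldsLocator f t s)
    (hN : ∀ i ≤ L, s.nat 4 i = 2 ^ i) (hC : ∀ i ≤ L, s.cpx 4 i = 2 ^ 2 ^ i) :
    Wp termsProgram s (fun s' n => n ≤ (t + 1) * ((L + 2) * 100 + (t + 1) * 300) ∧
      HoldsExpansion s' f) := by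
  have hm := hloc.1
  unfold termsProgram
  simp only [Wp.seq_iff, Wp.setNat_iff, Wp.setCpx_iff]
  refine (Wp.forLoop f.support.card ((L + 2) * 100 + (t + 1) * 200) (HoldsTerms f)
    ?_ ?_ rfl ?_).mono ?_
  · refine ⟨by simp, by simp, f.support, subset_rfl, by simp, by simp, fun h0 => ?_⟩
    -- for `m = 0` the index `m - 1` is truncated, but then no term is read off
    have := hloc.2 (f.support.card - 1) (by omega)
    simp [ht, hm, this, coeff_locator_eq_neg_sum h0]
  · intro s' h
    simp [h.nat 18 rfl, hm]
  · intro l s' hl hT hls hA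
    refine (termProgram_spec (t := t) (L := L) (l := l) hf hdeg ?_ ?_ ?_ ?_ ?_ ?_ hls hl hT).mono ?_
    · simp [hA.nat 0 rfl, ht]
    · simp [hA.nat 0 rfl, hL]
    · simpa [hA.cpx 2 rfl] using hs
    · simpa [HoldsLocator, hA.nat 18 rfl, hA.nat 13 rfl, hA.cpx 3 rfl] using hloc
    · simpa [hA.nat 4 rfl] using hN
    · simpa [hA.cpx 4 rfl] using hC
    · rintro s'' n ⟨hn, h⟩
      exact ⟨hn, by simpa [HoldsTerms] using h⟩
  · rintro s' n ⟨hn, ⟨T1, T2, A, -, -, T5, -⟩, hA⟩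
    have e18 : s'.nat 18 0 = f.support.card := by simp [hA.nat 18 rfl, hm]
    have hmem : ∀ i < f.support.card, s'.nat 1 i ∈ f.support := fun i hi =>
      (Finset.mem_sdiff.1 (T5 i hi)).1
    refine ⟨?_, ?_, ?_, ?_⟩
    · have h1 : (f.support.card + 1) * ((L + 2) * 100 + (t + 1) * 200 + 11) ≤
          (t + 1) * ((L + 2) * 100 + (t + 1) * 200 + 11) := Nat.mul_le_mul_right _ (by omega)
      simp at hn ⊢
      nlinarith
    · simpa [e18] using T2
    · simp [e18]
      intro j hj
      rw [T1 j hj]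
      exact mem_support_iff.1 (hmem j hj)
    · have hinj : Set.InjOn (s'.nat 1) (Finset.range f.support.card) := by
        intro i hi j hj
        exact T2 i (by simpa using hi) j (by simpa using hj)
      have himg : (Finset.range f.support.card).image (s'.nat 1) = f.support := by
        refine Finset.eq_of_subset_of_card_le (fun x hx => ?_) ?_
        · obtain ⟨i, hi, rfl⟩ := Finset.mem_image.1 hx
          exact hmem i (Finset.mem_range.1 hi)
        · rw [Finset.card_image_of_injOn hinj, Finset.card_range]
      simp only [Store.setNat_nat, Store.setNat_cpx, NExpr.eval, e18, and_self, if_true,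
        one_ne_zero, false_and, if_false]
      conv_lhs => rw [f.as_sum_support, ← himg, Finset.sum_image hinj]
      exact Finset.sum_congr rfl fun j hj => by rw [T1 j (Finset.mem_range.1 hj)]

/-- The interpolation algorithm: power sums, locator polynomial, terms. -/
def interpolationProgram : Program :=
  .seq powersProgram <| .seq samplesProgram <| .seq locatorProgram termsProgram

theorem interpolationProgram_spec {t : ℕ} {S : SLP} (hf : S.poly.support.card ≤ t) :
    Wp interpolationProgram (inputStore t S) (fun s' n =>
      n ≤ 100 * (S.length + 1) + (2 * t + 1) * (200 * (S.length + 1)) +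
        (t + 2) * ((t + 1) * ((2 * t + 2) * 400)) +
        (t + 1) * ((S.length + 2) * 100 + (t + 1) * 300) ∧
      HoldsExpansion s' S.poly) := by
  have hS : HoldsSLP S (inputStore t S) :=
    ⟨rfl, fun _ => rfl, fun _ => rfl, fun _ => rfl, fun _ => rfl⟩
  have ht : (inputStore t S).nat 0 0 = t := rfl
  unfold interpolationProgram
  simp only [Wp.seq_iff]
  refine (powersProgram_spec _ S.length hS.length).frame.mono ?_
  rintro s₁ n₁ ⟨⟨hn₁, hN, hC⟩, hA₁⟩
  have hS₁ := hS.of_agree hA₁ rfl rfl rfl rfl rfl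
  refine (samplesProgram_spec hS₁ ((congrFun (hA₁.nat 0 rfl) 0).trans ht)).frame.mono ?_
  rintro s₂ n₂ ⟨⟨hn₂, hs₂⟩, hA₂⟩
  have ht₂ : s₂.nat 0 0 = t := by rw [hA₂.nat 0 rfl, hA₁.nat 0 rfl, ht]
  refine (locatorProgram_spec hf ht₂ hs₂).frame.mono ?_
  rintro s₃ n₃ ⟨⟨hn₃, hloc⟩, hA₃⟩
  refine (termsProgram_spec (L := S.length) hf S.natDegree_poly_le ?_ ?_ ?_ hloc ?_ ?_).mono ?_
  · rw [hA₃.nat 0 rfl, ht₂]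
  · rw [hA₃.nat 0 rfl, hA₂.nat 0 rfl, hS₁.length]
  · rwa [hA₃.cpx 2 rfl]
  · rwa [hA₃.nat 4 rfl, hA₂.nat 4 rfl]
  · rwa [hA₃.cpx 4 rfl, hA₂.cpx 4 rfl]
  · rintro s' n ⟨hn, h⟩
    exact ⟨by omega, h⟩

theorem mainTheorem10 :
    (∃ (P : Program) (K : ℕ), ∀ (t : ℕ) (S : SLP), 1 ≤ t → 1 ≤ S.length →
      S.poly.support.card ≤ t →
      ∃ (s : Store) (n : ℕ), Exec P (inputStore t S) s n ∧
        n ≤ K * (t ^ 4 * S.length) ∧ HoldsExpansion s S.poly) ∧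
    (∀ (t : ℕ) (x : Fin t → ℝ) (f : ℂ[X]), (∀ j, 0 < x j) → Function.Injective x →
      f.support.card = t →
      IsUnit (eulerMatrix x f) ∧
        (eulerMatrix x (eulerD f) * (eulerMatrix x f)⁻¹).charpoly =
          ∏ α ∈ f.support, (X - C (α : ℂ))) := by
  refine ⟨⟨interpolationProgram, 20000, fun t S ht hL hf => ?_⟩,
    fun t x f hx hinj hf => eulerMatrix_charpoly x f hx hinj hf⟩
  obtain ⟨s, n, hE, hn, h⟩ := interpolationProgram_spec hf
  refine ⟨s, n, hE, hn.trans ?_, h⟩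
  generalize S.length = L at hL
  have h1 : 100 * (L + 1) ≤ t ^ 4 * L * 200 := by
    have : 1 ≤ t ^ 4 := Nat.one_le_pow _ _ ht
    nlinarith
  have h2 : t ≤ t ^ 4 := Nat.le_self_pow (by norm_num) t
  have h3 : t ^ 2 ≤ t ^ 4 := Nat.pow_le_pow_right ht (by norm_num)
  have h4 : t ^ 3 ≤ t ^ 4 := Nat.pow_le_pow_right ht (by norm_num)
  calc _ ≤ t ^ 4 * L * 200 + (3 * t) * (200 * (2 * L)) +
        (3 * t) * ((2 * t) * ((4 * t) * 400)) + (2 * t) * ((3 * L) * 100 + (2 * t) * 300) := by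
        gcongr <;> omega
    _ = t ^ 4 * L * 200 + 1800 * (t * L) + 9600 * t ^ 3 * 1 + 1200 * t ^ 2 * 1 := by ring
    _ ≤ t ^ 4 * L * 200 + 1800 * (t ^ 4 * L) + 9600 * t ^ 4 * L + 1200 * t ^ 4 * L := by
        gcongr
    _ ≤ 20000 * (t ^ 4 * L) := by linarith [Nat.zero_le (t ^ 4 * L)]
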